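/- Let $Q$ be a finite quiver with vertex set $I$ and arrow set $E$ (loops and multiple arrows allowed), and let $\mathbb F=\mathbb Q(q,t_e)_{e\in E}$, with $q$ and the $t_e$ independent variables. For $i,j\in I$ put $$\zeta_{ij}(x)=\left(\frac{1-xq^{-1}}{1-x}\right)^{\delta_{ij}}\prod_{e=\overrightarrow{ij}\in E}\left(\frac1{t_e}-x\right)\prod_{e=\overrightarrow{ji}\in E}\left(1-\frac{t_e}{qx}\right),\qquad \widetilde\zeta_{ij}(x)=\zeta_{ij}(x)(1-x)^{\delta_{ij}} .$$ Let $\widetilde{\mathbf U}^+$ be the $\mathbb F$-algebra generated by symbols $e_{i,d}$ ($i\in I$, $d\in\mathbb Z$) modulo the relations obtained by equating, for all $i,j\in I$, the coefficients of all monomials in $z,w$ in $$e_i(z)e_j(w)\,\widetilde\zeta_{ji}\!\left(\frac wz\right)z^{\delta_{ij}}=e_j(w)e_i(z)\,\widetilde\zeta_{ij}\!\left(\frac zw\right)(-w)^{\delta_{ij}},\qquad e_i(z)=\sum_{d\in\mathbb Z}e_{i,d}z^{-d}.$$ Let $\mathcal V=\bigoplus_{\boldsymbol n\in\mathbb N^I}\mathcal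 V_{\boldsymbol n}$, where $\mathcal V_{\boldsymbol n}$ is the space of Laurent polynomials over $\mathbb F$ in variables $z_{ia}$ ($i\in I$, $1\le a\le n_i$) that are symmetric in $z_{i1},\dots,z_{in_i}$ for each $i\in I$ separately ($\mathcal V$ is the big shuffle algebra, and $\mathcal V^{\mathrm{op}}$, its opposite algebra, has the same underlying vector space). Then there is exactly one bilinear pairing $\langle\cdot,\cdot\rangle:\widetilde{\mathbf U}^+\otimes\mathcal V^{\mathrm{op}}\to\mathbb F$ such that, for all $N\ge0$, $i_1,\dots,i_N\in I$, $d_1,\dots,d_N\in\mathbb Z$, $\boldsymbol n\in\mathbb N^I$ and $R\in\mathcal V_{\boldsymbol n}$, $$\langle e_{i_1,d_1}\cdots e_{i_N,d_N},R\rangle=\int_{|z_1|\gg\dots\gg|z_N|}\frac{z_1^{d_1}\cdots z_N^{d_N}R(z_1,\dots,z_N)}{\prod_{1\le a<b\le N}\zeta_{i_bi_a}(z_b/z_a)}\prod_{a=1}^N\frac{dz_a}{2\pi i z_a}$$ if each $i\in I$ occurs exactly $n_i$ times among $i_1,\dots,i_N$, and $\langle e_{i_1,d_1}\cdots e_{i_N,d_N},R\rangle=0$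 otherwise. Here $z_a$ is plugged into one of the variables $z_{i_a\bullet}$ of $R$, different $a$ using different variables (by symmetry the choice is immaterial), and the integral denotes the constant term of the expansion of the rational function in the region $|z_1|\gg\dots\gg|z_N|$. This pairing is non-degenerate in both arguments: if $\phi\in\widetilde{\mathbf U}^+$ satisfies $\langle\phi,R\rangle=0$ for all $R\in\mathcal V^{\mathrm{op}}$, then $\phi=0$; and if $R\in\mathcal V^{\mathrm{op}}$ satisfies $\langle\phi,R\rangle=0$ for all $\phi\in\widetilde{\mathbf U}^+$, then $R=0$. -/

import Mathlib

noncomputable section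

namespace QuiverShuffle

open LaurentPolynomial

/-- The ground field `𝔽 = ℚ(q, t_e)`, with one variable `t_e` for each arrow `e` of the quiver;
the index `none` stands for `q`. -/
def GroundField (I : Type*) [Quiver I] : Type _ :=
  FractionRing (MvPolynomial (Option (Quiver.Total I)) ℚ)

instance (I : Type*) [Quiver I] : Field (GroundField I) :=
  inferInstanceAs (Field (FractionRing (MvPolynomial (Option (Quiver.Total I)) ℚ)))

instance (I : Type*) [Quiver I] :
    Algebra (MvPolynomial (Option (Quiver.Total I)) ℚ) (GroundField I) :=
  OreLocalization.instAlgebra (R₀ := MvPolynomial (Option (Quiver.Total I)) ℚ)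

instance (I : Type*) [Quiver I] :
    IsFractionRing (MvPolynomial (Option (Quiver.Total I)) ℚ) (GroundField I) :=
  Localization.isLocalization

/-- The parameter `q ∈ 𝔽`. -/
def q (I : Type*) [Quiver I] : GroundField I :=
  algebraMap (MvPolynomial (Option (Quiver.Total I)) ℚ) (GroundField I) (MvPolynomial.X none)

/-- The parameter `t_e ∈ 𝔽` of an arrow `e : i ⟶ j`. -/
def t {I : Type*} [Quiver I] {i j : I} (e : i ⟶ j) : GroundField I :=
  algebraMap (MvPolynomial (Option (Quiver.Total I)) ℚ) (GroundField I)
    (MvPolynomial.X (some ⟨i, j, e⟩))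

section Quiver

variable {I : Type*} [DecidableEq I] [Quiver I] [∀ i j : I, Fintype (i ⟶ j)]

/-- The rational function `ζ_{ij}`, evaluated at an element `x` of a field `L` containing `𝔽`:
`((1 - x q⁻¹) / (1 - x)) ^ δ_{ij} * ∏_{e : i ⟶ j} (1 / t_e - x) * ∏_{e : j ⟶ i} (1 - t_e / (q x))`.
For `i = j` every loop occurs in both products. -/
def zeta {L : Type*} [Field L] [Algebra (GroundField I) L] (i j : I) (x : L) : L :=
  ((1 - x * (algebraMap (GroundField I) L (q I))⁻¹) / (1 - x)) ^ (if i = j then 1 else 0) *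
    (∏ e : i ⟶ j, (1 / algebraMap (GroundField I) L (t e) - x)) *
    ∏ e : j ⟶ i, (1 - algebraMap (GroundField I) L (t e) / (algebraMap (GroundField I) L (q I) * x))

/-- The Laurent polynomial `ζ_{ij}(x) * (1 - x) ^ δ_{ij}` in one variable `x = T 1`. -/
def zetaTilde (i j : I) : LaurentPolynomial (GroundField I) :=
  (1 - C (q I)⁻¹ * T 1) ^ (if i = j then 1 else 0) *
    (∏ e : i ⟶ j, (C (1 / t e) - T 1)) *
    ∏ e : j ⟶ i, (1 - C (t e / q I) * T (-1))

/-- The symbol `e_{i,d}` in the free algebra. -/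
def freeGen (i : I) (d : ℤ) : FreeAlgebra (GroundField I) (I × ℤ) :=
  FreeAlgebra.ι (GroundField I) (i, d)

/-- The quadratic relations `e_i(z) e_j(w) ζ_{ji}(w/z) = e_j(w) e_i(z) ζ_{ij}(z/w)`, where
`e_i(z) = ∑_d e_{i,d} z^{-d}`.  Clearing the denominators (for `i = j`, multiplying by `z - w`) gives
`e_i(z) e_j(w) ζ̃_{ji}(w/z) z^δ = e_j(w) e_i(z) ζ̃_{ij}(z/w) (-w)^δ` with `δ = δ_{ij}` and `ζ̃` as in
`zetaTilde`; the relation `quad i j k l` equates the coefficients of `z^{-k} w^{-l}`. -/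
inductive QuadRel :
    FreeAlgebra (GroundField I) (I × ℤ) → FreeAlgebra (GroundField I) (I × ℤ) → Prop
  | quad (i j : I) (k l : ℤ) : QuadRel
      ((zetaTilde j i).coeff.sum fun m c =>
        c • (freeGen i (k - m + if i = j then 1 else 0) * freeGen j (l + m)))
      ((-1) ^ (if i = j then 1 else 0) • (zetaTilde i j).coeff.sum fun m c =>
        c • (freeGen j (l - m + if i = j then 1 else 0) * freeGen i (k + m)))

variable (I) in
/-- The quadratic quantum loop group `Ũ⁺`: the `𝔽`-algebra generated by the symbols `e_{i,d}`,
`i ∈ I`, `d ∈ ℤ`, modulo the quadratic relations. -/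
abbrev QuadLoopGroup : Type _ :=
  RingQuot (QuadRel (I := I))

/-- The generator `e_{i,d}` of `Ũ⁺`. -/
def gen (i : I) (d : ℤ) : QuadLoopGroup I :=
  RingQuot.mkAlgHom (GroundField I) QuadRel (freeGen i d)

/-- The product `e_w = e_{i_1,d_1} ⋯ e_{i_N,d_N}` for the word `w = [i_1^{(d_1)} ⋯ i_N^{(d_N)}]`. -/
def wordElt {N : ℕ} (w : Fin N → I × ℤ) : QuadLoopGroup I :=
  (List.ofFn fun a => gen (w a).1 (w a).2).prod

/-- The horizontal degree `ς_{i_1} + ⋯ + ς_{i_N} ∈ ℕ^I` of a word. -/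
def hdeg {N : ℕ} (w : Fin N → I × ℤ) : I → ℕ :=
  fun i => Fintype.card {a : Fin N // (w a).1 = i}

end Quiver

section Shuffle

variable {I : Type*} [Quiver I]

/-- Laurent polynomials over `𝔽` in the variables `z_{ia}`, `i ∈ I`, `1 ≤ a ≤ n_i`. The exponent
vector `k` stands for the monomial `∏ z_{ia} ^ k_{ia}`. -/
abbrev LaurentPoly (n : I → ℕ) : Type _ :=
  AddMonoidAlgebra (GroundField I) ((Σ i, Fin (n i)) → ℤ)

/-- The Laurent polynomials that are symmetric in `z_{i1}, …, z_{i n_i}` for each `i ∈ I`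
separately. -/
def symLaurent (n : I → ℕ) : Submodule (GroundField I) (LaurentPoly n) where
  carrier := {R | ∀ (τ : ∀ i, Equiv.Perm (Fin (n i))) (k : (Σ i, Fin (n i)) → ℤ),
    R.coeff (fun p => k ⟨p.1, τ p.1 p.2⟩) = R.coeff k}
  zero_mem' := fun _ _ => rfl
  add_mem' := fun {R S} hR hS τ k => by
    simp only [AddMonoidAlgebra.coeff_add, Finsupp.add_apply, hR τ k, hS τ k]
  smul_mem' := fun c R hR τ k => by
    simp only [AddMonoidAlgebra.coeff_smul, Finsupp.smul_apply, hR τ k]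

variable (I) in
/-- The vector space underlying the big shuffle algebra `𝒱` (and its opposite algebra `𝒱^op`). -/
abbrev BigShuffle : Type _ :=
  DirectSum (I → ℕ) fun n => symLaurent n

instance : AddCommMonoid (BigShuffle I) :=
  inferInstanceAs (AddCommMonoid (DirectSum (I → ℕ) fun n => symLaurent n))

instance : Module (GroundField I) (BigShuffle I) :=
  inferInstanceAs (Module (GroundField I) (DirectSum (I → ℕ) fun n => symLaurent n))

/-- The field of Laurent series in `z_1, …, z_N` in which functions are expanded in the region
`|z_1| ≫ ⋯ ≫ |z_N|`: the exponent vector `k` stands for the monomial `∏ z_a ^ (-k_a)`, and the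
support of a series is well-ordered for the lexicographic order of these vectors `k`. In particular
`z_b / z_a` has positive valuation for `a < b`, so that `(1 - c z_b / z_a)⁻¹ = ∑_m c^m (z_b / z_a)^m`. -/
abbrev Expansions (I : Type*) [Quiver I] (N : ℕ) : Type _ :=
  HahnSeries (Lex (Fin N → ℤ)) (GroundField I)

/-- The variable `z_a` in the field of expansions. -/
def z {N : ℕ} (a : Fin N) : Expansions I N :=
  HahnSeries.single (toLex (-Pi.single a 1)) 1

/-- `R(z_1, …, z_N)`, where `z_a` is plugged into the variable of `R` with index `σ a`. -/
def plugIn {N : ℕ} {n : I → ℕ} (σ : Fin N ≃ Σ i, Fin (n i)) (R : LaurentPoly n) :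
    Expansions I N :=
  R.coeff.sum fun k c => algebraMap (GroundField I) (Expansions I N) c * ∏ a, z a ^ k (σ a)

/-- The integral `∫_{|z_1| ≫ ⋯ ≫ |z_N|} F ∏ dz_a / (2πi z_a)`: the constant term of the expansion
`F`. -/
def contourIntegral {N : ℕ} (F : Expansions I N) : GroundField I :=
  F.coeff 0

variable [Fintype I] [DecidableEq I] [∀ i j : I, Fintype (i ⟶ j)]

/-- The integrand
`z_1^{d_1} ⋯ z_N^{d_N} R(z_1, …, z_N) / ∏_{a < b} ζ_{i_b i_a}(z_b / z_a)`. -/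
def integrand {N : ℕ} {n : I → ℕ} (w : Fin N → I × ℤ) (σ : Fin N ≃ Σ i, Fin (n i))
    (R : LaurentPoly n) : Expansions I N :=
  ((∏ a, z a ^ (w a).2) * plugIn σ R) /
    ∏ p : Fin N × Fin N with p.1 < p.2, zeta (w p.2).1 (w p.1).1 (z p.2 / z p.1)

/-- `P` is the bilinear pairing `Ũ⁺ ⊗ 𝒱^op → 𝔽` given by the contour integrals: for a word `w` and
`R ∈ 𝒱_n`, the value `⟨e_w, R⟩` is the integral if `w` has horizontal degree `n` (for every way `σ`
of plugging each `z_a` into a variable `z_{i_a •}` of `R`, different ones for different `a`), and `0`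
otherwise. -/
def IsShufflePairing
    (P : QuadLoopGroup I →ₗ[GroundField I] BigShuffle I →ₗ[GroundField I] GroundField I) : Prop :=
  ∀ (N : ℕ) (w : Fin N → I × ℤ) (n : I → ℕ) (R : symLaurent n),
    (hdeg w = n → ∀ σ : Fin N ≃ Σ i, Fin (n i), (∀ a, (σ a).1 = (w a).1) →
      P (wordElt w) (DirectSum.of (fun n => symLaurent n) n R) =
        contourIntegral (integrand w σ (R : LaurentPoly n))) ∧
    (hdeg w ≠ n → P (wordElt w) (DirectSum.of (fun n => symLaurent n) n R) = 0)

end Shuffle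

end QuiverShuffle

end

/-! Well-definedness. The integral of a word is an expansion coefficient of $R$ times the kernel
$\prod_{a<b}1/\zeta_{i_bi_a}(z_b/z_a)$. For neighbouring positions $a,b$, drop the factor of the
pair $(a,b)$. The transposition of $a$ and $b$ keeps the order of every other pair, so the remaining
product has a single expansion valid both in the given region and in the transposed one: it lives in
Hahn series for the intersection of the two lexicographic orders (`exists_biLex_prod`,
`coeff_kernelErase_swap`). Multiplying the kernel by $\widetilde\zeta$ cancels the dropped factor up
to $(1-z_b/z_a)^{\delta}$, which, once denominators are cleared, is antisymmetric for equal colours.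
This gives the quadratic relations for the coefficients (`kernel_quadratic`), so the form on the
free algebra descends. Uniqueness holds because words span.

Non-degeneracy in $R$. For fixed colours and varying $d$, the integrals are all the coefficients of
$R$ times the kernel. These series form a field and the kernel is nonzero, so $R=0$.

Non-degeneracy in $\phi$. The kernel has an explicit leading exponent, `shift`. Measure exponents of
words relative to it. Then the extreme terms of the quadratic relation are $[i^{(x)}j^{(y)}]$ and
$[j^{(y+\delta)}i^{(x-\delta)}]$, and when the first is an inversion, all other terms begin with an
exponent smaller than $x$. An inverted word is thus a combination of lexicographically smaller ones.
A quadratic energy that never increases confines the rewriting to a finite set of words, so sorted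
words span (`sortedSpan_eq_top`). Pairing sorted words with orbit sums of monomials is triangular
with nonzero diagonal, because a sorted vector is the lexicographic minimum of its permutations and
the kernel starts at `shift`. A maximal word in the support of $\phi$ is then detected by its own
orbit sum. -/

noncomputable section

namespace QuiverShuffle

/-! ### Changing the exponents of Hahn series. -/

section HahnSeries

variable {Γ Γ' R : Type*} [AddCommGroup Γ] [PartialOrder Γ] [IsOrderedAddMonoid Γ]
  [AddCommGroup Γ'] [PartialOrder Γ'] [IsOrderedAddMonoid Γ'] [CommSemiring R]

/-- Reindexing of Hahn series along a monotone additive bijection of the exponents. -/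
def reindexHom (f : Γ ≃+ Γ') (hf : Monotone f) : HahnSeries Γ R →+* HahnSeries Γ' R where
  toFun x :=
    { coeff := fun g => x.coeff (f.symm g)
      isPWO_support' := (x.isPWO_support.image_of_monotone hf).mono fun g hg =>
        ⟨f.symm g, hg, f.apply_symm_apply g⟩ }
  map_one' := by
    ext g
    by_cases h : g = 0 <;> simp [HahnSeries.coeff_one, h]
  map_zero' := by
    ext g
    simp
  map_add' x y := by
    ext g
    simp
  map_mul' x y := by
    ext g
    simp only [HahnSeries.coeff_mul]
    refine Finset.sum_nbij' (fun p => (f p.1, f p.2)) (fun p => (f.symm p.1, f.symm p.2))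
      ?_ ?_ ?_ ?_ ?_
    · rintro ⟨u, v⟩ h
      simp only [Finset.mem_antidiagonal, HahnSeries.mem_support] at h ⊢
      simpa [← map_add, AddEquiv.eq_symm_apply] using h
    · rintro ⟨u, v⟩ h
      simp only [Finset.mem_antidiagonal, HahnSeries.mem_support] at h ⊢
      refine ⟨h.1, h.2.1, ?_⟩
      rw [← map_add, h.2.2]
    · simp
    · simp
    · simp

theorem coeff_reindexHom (f : Γ ≃+ Γ') (hf : Monotone f) (x : HahnSeries Γ R) (g : Γ') :
    (reindexHom f hf x).coeff g = x.coeff (f.symm g) := rfl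

/-- Substitution of the monomial with a positive exponent `g` into a Laurent series. -/
def substHom (g : Γ) (hg : 0 < g) : HahnSeries ℤ R →+* HahnSeries Γ R :=
  HahnSeries.embDomainRingHom (zmultiplesHom Γ g) (zsmul_left_strictMono hg).injective
    fun _ _ => (zsmul_left_strictMono hg).le_iff_le

theorem substHom_single (g : Γ) (hg : 0 < g) (m : ℤ) (r : R) :
    substHom g hg (HahnSeries.single m r) = HahnSeries.single (m • g) r :=
  HahnSeries.embDomain_single

/-- Lets a one-variable series substituted once, in the common order, be read in each of the two
regions. -/
theorem reindexHom_substHom (f : Γ ≃+ Γ') (hf : Monotone f) (g : Γ) (hg : 0 < g)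
    (hg' : 0 < f g) (x : HahnSeries ℤ R) :
    reindexHom f hf (substHom g hg x) = substHom (f g) hg' x := by
  ext u
  rw [coeff_reindexHom]
  by_cases h : ∃ m : ℤ, m • f g = u
  · obtain ⟨m, rfl⟩ := h
    rw [← map_zsmul, AddEquiv.symm_apply_apply]
    have h1 : (substHom g hg x).coeff (m • g) = x.coeff m :=
      HahnSeries.embDomain_mk_coeff (f := zmultiplesHom Γ g) _ _
    have h2 : (substHom (f g) hg' x).coeff (m • f g) = x.coeff m :=
      HahnSeries.embDomain_mk_coeff (f := zmultiplesHom Γ' (f g)) _ _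
    rw [map_zsmul, h1, h2]
  · have h1 : (substHom g hg x).coeff (f.symm u) = 0 := by
      refine HahnSeries.embDomain_of_notMem_range ?_
      rintro ⟨m, hm⟩
      refine h ⟨m, ?_⟩
      change m • g = f.symm u at hm
      rw [← map_zsmul, hm, AddEquiv.apply_symm_apply]
    have h2 : (substHom (f g) hg' x).coeff u = 0 := by
      refine HahnSeries.embDomain_of_notMem_range ?_
      rintro ⟨m, hm⟩
      exact h ⟨m, hm⟩
    rw [h1, h2]

end HahnSeries

/-! ### Exponent vectors ordered for two regions at once. -/

section BiLex

variable {N : ℕ}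

/-- Exponent vectors, with the intersection of the lexicographic order and of its twist by a
permutation of the coordinates. -/
def BiLex {N : ℕ} (_ : Equiv.Perm (Fin N)) : Type :=
  Fin N → ℤ

instance (s : Equiv.Perm (Fin N)) : AddCommGroup (BiLex s) :=
  inferInstanceAs (AddCommGroup (Fin N → ℤ))

/-- Permutation of the coordinates, into the lexicographically ordered vectors. -/
def permLex (s r : Equiv.Perm (Fin N)) : BiLex s ≃+ Lex (Fin N → ℤ) where
  toFun v := toLex (fun a => (show Fin N → ℤ from v) (r a))
  invFun v := (fun a => ofLex v (r.symm a) : Fin N → ℤ)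
  left_inv v := by
    funext a
    simp
  right_inv v := by
    apply ofLex.injective
    funext a
    simp
  map_add' _ _ := rfl

instance (s : Equiv.Perm (Fin N)) : PartialOrder (BiLex s) :=
  PartialOrder.lift (fun v => (permLex s 1 v, permLex s s v)) fun _ _ h =>
    (permLex s 1).injective (Prod.ext_iff.1 h).1

theorem BiLex.le_iff {s : Equiv.Perm (Fin N)} {u v : BiLex s} :
    u ≤ v ↔ permLex s 1 u ≤ permLex s 1 v ∧ permLex s s u ≤ permLex s s v :=
  Iff.rfl

instance (s : Equiv.Perm (Fin N)) : IsOrderedAddMonoid (BiLex s) where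
  add_le_add_left _ _ h _ := by
    rw [BiLex.le_iff] at h ⊢
    simp only [map_add]
    exact ⟨add_le_add_left h.1 _, add_le_add_left h.2 _⟩

/-- The exponent vector of `z_b / z_a`. -/
def rootVec (a b : Fin N) : Fin N → ℤ :=
  Pi.single a 1 - Pi.single b 1

theorem toLex_rootVec_pos {a b : Fin N} (h : a < b) : 0 < toLex (rootVec a b) := by
  refine ⟨a, fun c hc => ?_, ?_⟩
  · have h1 : c ≠ a := hc.ne
    have h2 : c ≠ b := (hc.trans h).ne
    change (0 : ℤ) = _
    simp [rootVec, h1, h2]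
  · change (0 : ℤ) < _
    simp [rootVec, h.ne]

theorem rootVec_comp (s : Equiv.Perm (Fin N)) (a b : Fin N) :
    (fun c => rootVec (s a) (s b) (s c)) = rootVec a b := by
  funext c
  simp [rootVec, Pi.single_apply]

end BiLex

section Monomials

variable {I : Type*} [Quiver I] {N : ℕ}

theorem z_ne_zero (a : Fin N) : (z a : Expansions I N) ≠ 0 :=
  HahnSeries.single_ne_zero one_ne_zero

theorem z_div_z (a b : Fin N) :
    z b / z a = (HahnSeries.single (toLex (rootVec a b)) 1 : Expansions I N) := by
  rw [div_eq_iff (z_ne_zero a), z, z, HahnSeries.single_mul_single, mul_one]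
  have h : -Pi.single b (1 : ℤ) = rootVec a b + -Pi.single a 1 := by
    rw [rootVec]
    abel
  rw [h, toLex_add]

end Monomials

/-! ### The kernel, and its common expansion in two neighbouring regions. -/

section ZetaProduct

variable {I : Type*} [DecidableEq I] [Quiver I] [∀ i j : I, Fintype (i ⟶ j)] {N : ℕ}

theorem map_zeta {L L' : Type*} [Field L] [Field L'] [Algebra (GroundField I) L]
    [Algebra (GroundField I) L'] (φ : L →+* L')
    (hφ : ∀ c, φ (algebraMap (GroundField I) L c) = algebraMap (GroundField I) L' c)
    (i j : I) (x : L) : φ (zeta i j x) = zeta i j (φ x) := by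
  simp only [zeta, map_mul, map_pow, map_div₀, map_sub, map_one, map_prod, map_inv₀, hφ]

/-- `ζ_{ij}(x)` as a Laurent series in `x`. -/
def zetaSeries (i j : I) : HahnSeries ℤ (GroundField I) :=
  zeta i j (HahnSeries.single 1 1)

theorem zeta_single (i j : I) {g : Lex (Fin N → ℤ)} (hg : 0 < g) :
    zeta i j (HahnSeries.single g 1 : Expansions I N) = substHom g hg (zetaSeries i j) := by
  have h := map_zeta (L := HahnSeries ℤ (GroundField I)) (L' := Expansions I N)
    (substHom g hg) (fun c => ?_) i j (HahnSeries.single 1 1)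
  · rw [zetaSeries, h, substHom_single, one_smul]
  · rw [HahnSeries.algebraMap_apply', HahnSeries.algebraMap_apply, PowerSeries.algebraMap_apply,
      Algebra.algebraMap_self, RingHom.id_apply, HahnSeries.ofPowerSeries_C,
      HahnSeries.C_apply, HahnSeries.C_apply, substHom_single, zero_smul]

/-- The factor of the integrand of a word with colours `c` attached to a pair of positions. -/
def zetaInv (c : Fin N → I) (p : Fin N × Fin N) : Expansions I N :=
  (zeta (c p.2) (c p.1) (z p.2 / z p.1))⁻¹

theorem zetaInv_eq_substHom (c : Fin N → I) {p : Fin N × Fin N} (hp : p.1 < p.2) :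
    zetaInv c p =
      substHom (toLex (rootVec p.1 p.2)) (toLex_rootVec_pos hp) (zetaSeries (c p.2) (c p.1))⁻¹ := by
  rw [zetaInv, z_div_z, zeta_single _ _ (toLex_rootVec_pos hp), map_inv₀]

/-- The pairs of positions of a word. -/
def pairs (N : ℕ) : Finset (Fin N × Fin N) :=
  {p | p.1 < p.2}

theorem mem_pairs {p : Fin N × Fin N} : p ∈ pairs N ↔ p.1 < p.2 := by
  simp [pairs]

/-- An adjacent transposition has exactly one inversion; adjacency is essential. -/
theorem swap_lt_swap {a b : Fin N} (hab : (a : ℕ) + 1 = b) {x y : Fin N} (hxy : x < y)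
    (h : (x, y) ≠ (a, b)) : Equiv.swap a b x < Equiv.swap a b y := by
  have h' : ¬ (x = a ∧ y = b) := fun h' => h (by rw [h'.1, h'.2])
  simp only [Equiv.swap_apply_def]
  simp only [Fin.lt_def, Fin.ext_iff] at *
  split_ifs <;> omega

/-- Transposing two neighbouring positions permutes the other pairs of positions. -/
@[to_additive]
theorem prod_pairs_erase_swap {M : Type*} [CommMonoid M] {a b : Fin N} (hab : (a : ℕ) + 1 = b)
    (f : Fin N × Fin N → M) :
    ∏ p ∈ (pairs N).erase (a, b), f (Equiv.swap a b p.1, Equiv.swap a b p.2) =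
      ∏ p ∈ (pairs N).erase (a, b), f p := by
  have hne : a ≠ b := by
    rintro rfl
    omega
  have key : ∀ p ∈ (pairs N).erase (a, b),
      (Equiv.swap a b p.1, Equiv.swap a b p.2) ∈ (pairs N).erase (a, b) := by
    rintro ⟨x, y⟩ h
    rw [Finset.mem_erase, mem_pairs] at h ⊢
    refine ⟨fun h' => ?_, swap_lt_swap hab h.2 h.1⟩
    rw [Prod.mk.injEq] at h'
    have h1 : x = b := by
      simpa using congrArg (Equiv.swap a b) h'.1
    have h2 : y = a := by
      simpa using congrArg (Equiv.swap a b) h'.2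
    have h3 : x < y := h.2
    rw [h1, h2, Fin.lt_def] at h3
    omega
  refine Finset.prod_nbij' (fun p => (Equiv.swap a b p.1, Equiv.swap a b p.2))
    (fun p => (Equiv.swap a b p.1, Equiv.swap a b p.2)) key key ?_ ?_ ?_ <;> simp

/-- The exponent vector of `z_b / z_a`, as an element of `BiLex s`. -/
def biRoot (s : Equiv.Perm (Fin N)) (a b : Fin N) : BiLex s :=
  rootVec a b

theorem permLex_one_rootVec (s : Equiv.Perm (Fin N)) (x y : Fin N) :
    permLex s 1 (biRoot s x y) = toLex (rootVec x y) := rfl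

theorem permLex_rootVec {s : Equiv.Perm (Fin N)} (hs : ∀ x, s (s x) = x) (x y : Fin N) :
    permLex s s (biRoot s x y) = toLex (rootVec (s x) (s y)) := by
  have h := rootVec_comp s (s x) (s y)
  rw [hs, hs] at h
  exact congrArg toLex h

theorem monotone_permLex_one (s : Equiv.Perm (Fin N)) : Monotone (permLex s 1) :=
  fun _ _ h => h.1

theorem monotone_permLex (s : Equiv.Perm (Fin N)) : Monotone (permLex s s) :=
  fun _ _ h => h.2

/-- A product of factors for pairs whose order is kept by `s` has a common expansion in the region
`|z_1| ≫ ⋯ ≫ |z_N|` and in its image under `s`. -/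
theorem exists_biLex_prod {s : Equiv.Perm (Fin N)} (hs : ∀ x, s (s x) = x) (c : Fin N → I)
    (T : Finset (Fin N × Fin N)) (hT : ∀ p ∈ T, p.1 < p.2 ∧ s p.1 < s p.2) :
    ∃ H : HahnSeries (BiLex s) (GroundField I),
      reindexHom (permLex s 1) (monotone_permLex_one s) H = ∏ p ∈ T, zetaInv c p ∧
      reindexHom (permLex s s) (monotone_permLex s) H =
        ∏ p ∈ T, zetaInv (c ∘ s) (s p.1, s p.2) := by
  induction T using Finset.induction_on with
  | empty => exact ⟨1, by simp, by simp⟩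
  | insert p T hp ih =>
    obtain ⟨H, h1, h2⟩ := ih fun q hq => hT q (Finset.mem_insert_of_mem hq)
    obtain ⟨hlt, hlt'⟩ := hT p (Finset.mem_insert_self p T)
    have e1 := permLex_one_rootVec s p.1 p.2
    have e2 := permLex_rootVec hs p.1 p.2
    have p1 : 0 < permLex s 1 (biRoot s p.1 p.2) := e1 ▸ toLex_rootVec_pos hlt
    have p2 : 0 < permLex s s (biRoot s p.1 p.2) := e2 ▸ toLex_rootVec_pos hlt'
    have hpos : 0 < biRoot s p.1 p.2 := by
      refine lt_of_le_of_ne ?_ ?_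
      · rw [BiLex.le_iff, map_zero, map_zero]
        exact ⟨p1.le, p2.le⟩
      · intro h
        rw [← h, map_zero] at p1
        exact p1.false
    -- The inverse is taken among Laurent series in one variable, before substituting: the order on
    -- `BiLex s` is only partial, so field inversion of Hahn series is not at hand there.
    refine ⟨substHom _ hpos (zetaSeries (c p.2) (c p.1))⁻¹ * H, ?_, ?_⟩
    · rw [map_mul, h1, Finset.prod_insert hp, zetaInv_eq_substHom c hlt,
        reindexHom_substHom _ _ _ _ p1]
      rfl
    · rw [map_mul, h2, Finset.prod_insert hp, zetaInv_eq_substHom (p := (s p.1, s p.2)) _ hlt',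
        reindexHom_substHom _ _ _ _ p2]
      simp only [e2, Function.comp_apply, hs]

/-- `∏ 1 / ζ_{i_b i_a}(z_b / z_a)` over the pairs of positions other than `(a, b)`. -/
def kernelErase (c : Fin N → I) (a b : Fin N) : Expansions I N :=
  ∏ p ∈ (pairs N).erase (a, b), zetaInv c p

/-- `∏ 1 / ζ_{i_b i_a}(z_b / z_a)` over all pairs of positions. -/
def kernel (c : Fin N → I) : Expansions I N :=
  ∏ p ∈ pairs N, zetaInv c p

/-- Both sides are coefficients of one series over `BiLex s`, read through its two maps to
lexicographic exponents. The only factor whose expansion depends on the order of `a` and `b` has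
been removed. -/
theorem coeff_kernelErase_swap (c : Fin N → I) {a b : Fin N} (hab : (a : ℕ) + 1 = b)
    (v : Fin N → ℤ) :
    (kernelErase (c ∘ Equiv.swap a b) a b).coeff (toLex (v ∘ Equiv.swap a b)) =
      (kernelErase c a b).coeff (toLex v) := by
  set s := Equiv.swap a b with hs
  obtain ⟨H, h1, h2⟩ := exists_biLex_prod (s := s) (Equiv.swap_apply_self a b) c
    ((pairs N).erase (a, b)) fun p hp => by
      rw [Finset.mem_erase, mem_pairs] at hp
      exact ⟨hp.2, swap_lt_swap hab hp.2 hp.1⟩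
  rw [prod_pairs_erase_swap hab (zetaInv (c ∘ s))] at h2
  rw [kernelErase, kernelErase, ← h1, ← h2, coeff_reindexHom, coeff_reindexHom]
  congr 1
  funext x
  change v (s (s.symm x)) = v x
  rw [Equiv.apply_symm_apply]

theorem kernel_eq (c : Fin N → I) {a b : Fin N} (hab : a < b) :
    kernel c = zetaInv c (a, b) * kernelErase c a b :=
  (Finset.mul_prod_erase _ _ (mem_pairs.2 hab)).symm

end ZetaProduct

open LaurentPolynomial

/-! ### Nonvanishing of parameters and leading exponents of expansions. -/

section Parameters

variable {I : Type*} [Quiver I]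

theorem algebraMap_groundField_injective :
    Function.Injective
      (algebraMap (MvPolynomial (Option (Quiver.Total I)) ℚ) (GroundField I)) :=
  IsFractionRing.injective _ _

theorem q_ne_zero : q I ≠ 0 :=
  (map_ne_zero_iff _ algebraMap_groundField_injective).2 (MvPolynomial.X_ne_zero _)

theorem t_ne_zero {i j : I} (e : i ⟶ j) : t e ≠ 0 :=
  (map_ne_zero_iff _ algebraMap_groundField_injective).2 (MvPolynomial.X_ne_zero _)

instance : CharZero (GroundField I) :=
  charZero_of_injective_algebraMap algebraMap_groundField_injective

end Parameters

section Order

variable {I : Type*} [Quiver I] {N : ℕ}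

/-- `x` is a nonzero expansion with leading exponent `g`. -/
def HasOrd (x : Expansions I N) (g : Lex (Fin N → ℤ)) : Prop :=
  x ≠ 0 ∧ x.order = g

theorem HasOrd.mul {x y : Expansions I N} {g h : Lex (Fin N → ℤ)} (hx : HasOrd x g)
    (hy : HasOrd y h) : HasOrd (x * y) (g + h) :=
  ⟨mul_ne_zero hx.1 hy.1, by rw [HahnSeries.order_mul hx.1 hy.1, hx.2, hy.2]⟩

theorem HasOrd.one : HasOrd (1 : Expansions I N) 0 :=
  ⟨one_ne_zero, HahnSeries.order_one⟩

theorem HasOrd.neg {x : Expansions I N} {g : Lex (Fin N → ℤ)} (hx : HasOrd x g) :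
    HasOrd (-x) g :=
  ⟨neg_ne_zero.2 hx.1, by rw [HahnSeries.order_neg, hx.2]⟩

theorem HasOrd.inv {x : Expansions I N} {g : Lex (Fin N → ℤ)} (hx : HasOrd x g) :
    HasOrd x⁻¹ (-g) := by
  refine ⟨inv_ne_zero hx.1, ?_⟩
  have h := HahnSeries.order_mul hx.1 (inv_ne_zero hx.1)
  rw [mul_inv_cancel₀ hx.1, HahnSeries.order_one, hx.2] at h
  exact (neg_eq_of_add_eq_zero_right h.symm).symm

theorem HasOrd.prod {ι : Type*} (s : Finset ι) {f : ι → Expansions I N}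
    {g : ι → Lex (Fin N → ℤ)} (h : ∀ i ∈ s, HasOrd (f i) (g i)) :
    HasOrd (∏ i ∈ s, f i) (∑ i ∈ s, g i) := by
  induction s using Finset.cons_induction with
  | empty => simpa using HasOrd.one
  | cons a s ha ih =>
    rw [Finset.prod_cons, Finset.sum_cons]
    exact (h a (Finset.mem_cons_self a s)).mul
      (ih fun i hi => h i (Finset.mem_cons_of_mem hi))

theorem HasOrd.coeff_ne_zero {x : Expansions I N} {g : Lex (Fin N → ℤ)} (hx : HasOrd x g) :
    x.coeff g ≠ 0 := by
  rw [← hx.2]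
  exact fun h => hx.1 (HahnSeries.coeff_order_eq_zero.1 h)

theorem HasOrd.le_of_coeff_ne_zero {x : Expansions I N} {g h : Lex (Fin N → ℤ)}
    (hx : HasOrd x g) (hh : x.coeff h ≠ 0) : g ≤ h :=
  hx.2 ▸ HahnSeries.order_le_of_coeff_ne_zero hh

theorem hasOrd_single_sub_single {u v : Lex (Fin N → ℤ)} (huv : u < v) {a : GroundField I}
    (ha : a ≠ 0) (b : GroundField I) :
    HasOrd (HahnSeries.single u a - HahnSeries.single v b : Expansions I N) u := by
  have hu : (HahnSeries.single u a - HahnSeries.single v b : Expansions I N).coeff u = a := by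
    rw [HahnSeries.coeff_sub, HahnSeries.coeff_single_same, HahnSeries.coeff_single_of_ne huv.ne,
      sub_zero]
  have h0 : (HahnSeries.single u a - HahnSeries.single v b : Expansions I N) ≠ 0 := by
    intro h
    rw [h, HahnSeries.coeff_zero] at hu
    exact ha hu.symm
  refine ⟨h0, le_antisymm (HahnSeries.order_le_of_coeff_ne_zero (by rwa [hu])) ?_⟩
  by_contra! h
  refine h0 (HahnSeries.coeff_order_eq_zero.1 ?_)
  rw [HahnSeries.coeff_sub, HahnSeries.coeff_single_of_ne h.ne,
    HahnSeries.coeff_single_of_ne (h.trans huv).ne, sub_zero]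

theorem algebraMap_expansions (c : GroundField I) :
    algebraMap (GroundField I) (Expansions I N) c = HahnSeries.single 0 c := by
  rw [HahnSeries.algebraMap_apply, Algebra.algebraMap_self, RingHom.id_apply, HahnSeries.C_apply]

theorem single_zpow (g : Lex (Fin N → ℤ)) (m : ℤ) :
    (HahnSeries.single g 1 : Expansions I N) ^ m = HahnSeries.single (m • g) 1 := by
  have h (n : ℕ) : (HahnSeries.single g 1 : Expansions I N) ^ n = HahnSeries.single (n • g) 1 := by
    rw [HahnSeries.single_pow, one_pow]
  cases m with
  | ofNat n => rw [Int.ofNat_eq_natCast, zpow_natCast, h, natCast_zsmul]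
  | negSucc n =>
    rw [zpow_negSucc, h, negSucc_zsmul]
    refine inv_eq_of_mul_eq_one_right ?_
    rw [HahnSeries.single_mul_single, add_neg_cancel, mul_one]
    rfl

theorem inv_single (g : Lex (Fin N → ℤ)) :
    (HahnSeries.single g 1 : Expansions I N)⁻¹ = HahnSeries.single (-g) 1 := by
  simp

variable [DecidableEq I] [∀ i j : I, Fintype (i ⟶ j)]

/-- Only the factors $1-t_e/(qx)$ contribute: each has leading exponent `-g`, all the others start
with a nonzero constant. -/
theorem hasOrd_zeta (i j : I) {g : Lex (Fin N → ℤ)} (hg : 0 < g) :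
    HasOrd (zeta i j (HahnSeries.single g 1 : Expansions I N))
      (-(Fintype.card (j ⟶ i) • g)) := by
  have one_eq : (1 : Expansions I N) = HahnSeries.single 0 1 := rfl
  have h1 : HasOrd (((1 - HahnSeries.single g 1 *
      (algebraMap (GroundField I) (Expansions I N) (q I))⁻¹) /
      (1 - HahnSeries.single g 1)) ^ (if i = j then 1 else 0)) 0 := by
    split_ifs
    · rw [pow_one, div_eq_mul_inv, ← map_inv₀, algebraMap_expansions,
        HahnSeries.single_mul_single, add_zero, one_eq]
      simpa using (hasOrd_single_sub_single hg one_ne_zero _).mul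
        (hasOrd_single_sub_single (I := I) hg one_ne_zero 1).inv
    · rw [pow_zero]
      exact HasOrd.one
  have h2 : HasOrd (∏ e : i ⟶ j, (1 / algebraMap (GroundField I) (Expansions I N) (t e) -
      HahnSeries.single g 1)) 0 := by
    have := HasOrd.prod (Finset.univ : Finset (i ⟶ j))
      (f := fun e => 1 / algebraMap (GroundField I) (Expansions I N) (t e) -
      HahnSeries.single g 1) (g := fun _ => 0) fun e _ => by
        rw [one_div, ← map_inv₀, algebraMap_expansions]
        exact hasOrd_single_sub_single hg (inv_ne_zero (t_ne_zero e)) 1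
    simpa using this
  have h3 : HasOrd (∏ e : j ⟶ i, (1 - algebraMap (GroundField I) (Expansions I N) (t e) /
      (algebraMap (GroundField I) (Expansions I N) (q I) * HahnSeries.single g 1)))
      (-(Fintype.card (j ⟶ i) • g)) := by
    have := HasOrd.prod (Finset.univ : Finset (j ⟶ i))
      (f := fun e => 1 - algebraMap (GroundField I) (Expansions I N) (t e) /
      (algebraMap (GroundField I) (Expansions I N) (q I) * HahnSeries.single g 1))
      (g := fun _ => -g) fun e _ => by
        rw [← div_div, ← map_div₀, algebraMap_expansions, div_eq_mul_inv, inv_single,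
          HahnSeries.single_mul_single, zero_add, mul_one, one_eq, ← neg_sub]
        exact (hasOrd_single_sub_single (neg_lt_zero.2 hg)
          (div_ne_zero (t_ne_zero e) q_ne_zero) 1).neg
    simpa using this
  simpa [zeta] using (h1.mul h2).mul h3

/-- The number of arrows from `i` to `j`. -/
def arrows (i j : I) : ℤ :=
  Fintype.card (i ⟶ j)

/-- The leading exponent of `∏ 1 / ζ_{i_b i_a}(z_b / z_a)`. -/
def shift (c : Fin N → I) : Fin N → ℤ :=
  ∑ p ∈ pairs N, arrows (c p.1) (c p.2) • rootVec p.1 p.2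

theorem hasOrd_kernel (c : Fin N → I) : HasOrd (kernel c) (toLex (shift c)) := by
  have h : toLex (shift c) =
      ∑ p ∈ pairs N, - -(Fintype.card (c p.1 ⟶ c p.2) • toLex (rootVec p.1 p.2)) := by
    simp only [neg_neg, ← natCast_zsmul]
    rfl
  rw [h]
  refine HasOrd.prod _ fun p hp => ?_
  rw [zetaInv, z_div_z]
  exact (hasOrd_zeta _ _ (toLex_rootVec_pos (mem_pairs.1 hp))).inv

end Order

/-! ### The quadratic relation for the kernel coefficients. -/

section Relation

variable {I : Type*} [DecidableEq I] [Quiver I] [∀ i j : I, Fintype (i ⟶ j)] {N : ℕ}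

theorem sum_zetaTilde (i j : I) {g : Lex (Fin N → ℤ)} (hg : 0 < g) :
    ((zetaTilde i j).coeff.sum fun m c => HahnSeries.single (m • g) c : Expansions I N) =
      zeta i j (HahnSeries.single g 1) *
        (1 - HahnSeries.single g 1) ^ (if i = j then 1 else 0) := by
  have hx : (HahnSeries.single g 1 : Expansions I N) ≠ 0 := HahnSeries.single_ne_zero one_ne_zero
  set x : (Expansions I N)ˣ := Units.mk0 _ hx with hxdef
  have h1 (p : LaurentPolynomial (GroundField I)) :
      LaurentPolynomial.eval₂ (algebraMap (GroundField I) (Expansions I N)) x p =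
        p.coeff.sum fun m c => HahnSeries.single (m • g) c := by
    induction p using LaurentPolynomial.induction_on' with
    | add p q hp hq =>
      rw [map_add, hp, hq, AddMonoidAlgebra.coeff_add, Finsupp.sum_add_index']
      · simp
      · simp
    | C_mul_T n a =>
      rw [eval₂_C_mul_T, ← single_eq_C_mul_T, AddMonoidAlgebra.coeff_single,
        Finsupp.sum_single_index (by simp), Units.val_zpow_eq_zpow_val, hxdef, Units.val_mk0,
        single_zpow, algebraMap_expansions, HahnSeries.single_mul_single, zero_add, mul_one]
  have h2 : (1 - HahnSeries.single g 1 : Expansions I N) ≠ 0 :=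
    (hasOrd_single_sub_single hg one_ne_zero 1).1
  rw [← h1, zetaTilde, zeta]
  simp only [map_mul, map_pow, map_prod, map_sub, map_one, eval₂_C, eval₂_T, map_inv₀, map_div₀,
    hxdef, Units.val_mk0, zpow_one, zpow_neg]
  have h3 : ((1 - (algebraMap (GroundField I) (Expansions I N) (q I))⁻¹ *
      HahnSeries.single g 1) ^ (if i = j then 1 else 0) : Expansions I N) =
      ((1 - HahnSeries.single g 1 * (algebraMap (GroundField I) (Expansions I N) (q I))⁻¹) /
      (1 - HahnSeries.single g 1)) ^ (if i = j then 1 else 0) *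
      (1 - HahnSeries.single g 1) ^ (if i = j then 1 else 0) := by
    rw [← mul_pow, div_mul_cancel₀ _ h2, mul_comm]
  have h4 : ∏ e : j ⟶ i, (1 - algebraMap (GroundField I) (Expansions I N) (t e) /
      algebraMap (GroundField I) (Expansions I N) (q I) * (HahnSeries.single g 1)⁻¹) =
      ∏ e : j ⟶ i, (1 - algebraMap (GroundField I) (Expansions I N) (t e) /
        (algebraMap (GroundField I) (Expansions I N) (q I) * HahnSeries.single g 1)) :=
    Finset.prod_congr rfl fun e _ => by rw [← div_eq_mul_inv, div_div]
  rw [h3]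
  simp only [Units.val_inv_eq_inv_val, Units.val_mk0]
  rw [h4]
  simp only [one_div]
  generalize (∏ e : j ⟶ i, (1 - algebraMap (GroundField I) (Expansions I N) (t e) /
        (algebraMap (GroundField I) (Expansions I N) (q I) * HahnSeries.single g 1))) = u
  ring

/-- Coefficient form of the cancellation of $\widetilde\zeta(z_b/z_a)$ against the factor of the
pair `(a, b)`, which leaves $(1-z_b/z_a)^{\delta}$. -/
theorem coeff_kernel_relation (c : Fin N → I) {a b : Fin N} (hab : a < b) (v : Fin N → ℤ) :
    ((zetaTilde (c b) (c a)).coeff.sum fun m r =>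
      r * (kernel c).coeff (toLex (v - m • rootVec a b))) =
      (kernelErase c a b).coeff (toLex v) - if c a = c b then
        (kernelErase c a b).coeff (toLex (v - rootVec a b)) else 0 := by
  have hg := toLex_rootVec_pos hab
  have h : ((zetaTilde (c b) (c a)).coeff.sum fun m r =>
      HahnSeries.single (m • toLex (rootVec a b)) r : Expansions I N) * kernel c =
      (1 - HahnSeries.single (toLex (rootVec a b)) 1) ^ (if c b = c a then 1 else 0) *
        kernelErase c a b := by
    rw [sum_zetaTilde _ _ hg, kernel_eq c hab, zetaInv, z_div_z]
    have := (hasOrd_zeta (c b) (c a) hg).1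
    field_simp
  have h' := congrArg (fun x => x.coeff (toLex v)) h
  rw [Finsupp.sum, Finset.sum_mul] at h'
  simp only [HahnSeries.coeff_sum, HahnSeries.coeff_single_mul] at h'
  refine Eq.trans ?_ (h'.trans ?_)
  · rfl
  · by_cases hc : c a = c b
    · rw [if_pos hc, if_pos hc.symm, pow_one, sub_mul, one_mul, HahnSeries.coeff_sub,
        HahnSeries.coeff_single_mul, one_mul]
      rfl
    · rw [if_neg hc, if_neg (Ne.symm hc), pow_zero, one_mul, sub_zero]

/-- The quadratic relation for the expansion coefficients of the kernel. -/
theorem kernel_quadratic (c : Fin N → I) {a b : Fin N} (hab : (a : ℕ) + 1 = b) (v : Fin N → ℤ)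
    (k l : ℤ) :
    ((zetaTilde (c b) (c a)).coeff.sum fun m r =>
      r * (kernel c).coeff (toLex (v + Pi.single a (k - m + if c a = c b then 1 else 0) +
        Pi.single b (l + m)))) =
    (-1) ^ (if c a = c b then 1 else 0) * ((zetaTilde (c a) (c b)).coeff.sum fun m r =>
      r * (kernel (c ∘ Equiv.swap a b)).coeff (toLex (v ∘ Equiv.swap a b +
        Pi.single a (l - m + if c a = c b then 1 else 0) + Pi.single b (k + m)))) := by
  have hlt : a < b := by
    rw [Fin.lt_def]
    omega
  have h1 := coeff_kernel_relation c hlt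
    (v + Pi.single a (k + if c a = c b then 1 else 0) + Pi.single b l)
  have h2 := coeff_kernel_relation (c ∘ Equiv.swap a b) hlt
    (v ∘ Equiv.swap a b + Pi.single a (l + if c a = c b then 1 else 0) + Pi.single b k)
  simp only [Function.comp_apply, Equiv.swap_apply_left, Equiv.swap_apply_right] at h2
  have e1 (w : Fin N → ℤ) (x y m d : ℤ) : w + Pi.single a (x + d) + Pi.single b y -
      m • rootVec a b = w + Pi.single a (x - m + d) + Pi.single b (y + m) := by
    funext n
    simp only [rootVec, Pi.add_apply, Pi.sub_apply, Pi.smul_apply, Pi.single_apply, smul_eq_mul]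
    split_ifs <;> ring
  simp only [e1] at h1 h2
  rw [h1, h2]
  have e2 (w : Fin N → ℤ) (x y : ℤ) : w ∘ Equiv.swap a b + Pi.single a x + Pi.single b y =
      (w + Pi.single b x + Pi.single a y) ∘ Equiv.swap a b := by
    funext n
    simp only [Pi.add_apply, Function.comp_apply, Pi.single_apply,
      Equiv.swap_apply_eq_iff, Equiv.swap_apply_left, Equiv.swap_apply_right]
  have e3 (w : Fin N → ℤ) (x y : ℤ) : w ∘ Equiv.swap a b + Pi.single a x + Pi.single b y -
      rootVec a b = (w + Pi.single a (y + 1) + Pi.single b (x - 1)) ∘ Equiv.swap a b := by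
    have := e1 (w ∘ Equiv.swap a b) x y 1 0
    rw [one_smul, add_zero, add_zero] at this
    rw [this, e2, add_right_comm]
  have e4 (w : Fin N → ℤ) (x y : ℤ) : w + Pi.single a x + Pi.single b y - rootVec a b =
      w + Pi.single a (x - 1) + Pi.single b (y + 1) := by
    have := e1 w x y 1 0
    rwa [one_smul, add_zero, add_zero] at this
  rw [e3, e2, e4, coeff_kernelErase_swap c hab, coeff_kernelErase_swap c hab,
    add_right_comm v (Pi.single b _)]
  -- For equal colours the two terms from $1-z_b/z_a$ are exchanged by the transposition; the sign
  -- $(-1)^{\delta}$ compensates.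
  by_cases h : c a = c b
  · simp only [h, if_true, add_sub_cancel_right]
    ring
  · simp [h, Ne.symm h]

end Relation

/-! ### Contour integrals as linear forms. -/

section Integral

variable {I : Type*} [Quiver I] {N : ℕ} {n : I → ℕ}

theorem prod_z_zpow (d : Fin N → ℤ) :
    ∏ a, (z a : Expansions I N) ^ d a = HahnSeries.single (toLex (-d)) 1 := by
  have h (s : Finset (Fin N)) : ∏ a ∈ s, (z a : Expansions I N) ^ d a =
      HahnSeries.single (∑ a ∈ s, d a • toLex (-Pi.single a 1)) 1 := by
    induction s using Finset.cons_induction with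
    | empty => rfl
    | cons a s ha ih =>
      rw [Finset.prod_cons, Finset.sum_cons, ih, z, single_zpow, HahnSeries.single_mul_single,
        mul_one]
  have h1 : ∑ a, d a • (-Pi.single a (1 : ℤ) : Fin N → ℤ) = -d := by
    funext b
    simp [Finset.sum_apply, Pi.single_apply]
  rw [h, ← h1]
  rfl

theorem plugIn_eq (σ : Fin N ≃ Σ i, Fin (n i)) (R : LaurentPoly (I := I) n) :
    plugIn σ R = R.coeff.sum fun κ r => HahnSeries.single (toLex (-(κ ∘ σ))) r := by
  refine Finsupp.sum_congr fun κ _ => ?_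
  have h := prod_z_zpow (I := I) (κ ∘ σ)
  simp only [Function.comp_apply] at h
  rw [h, algebraMap_expansions, HahnSeries.single_mul_single, zero_add, mul_one]

theorem coeff_plugIn (σ : Fin N ≃ Σ i, Fin (n i)) (R : LaurentPoly (I := I) n)
    (κ : (Σ i, Fin (n i)) → ℤ) :
    (plugIn σ R).coeff (toLex (-(κ ∘ σ))) = R.coeff κ := by
  rw [plugIn_eq, Finsupp.sum, HahnSeries.coeff_sum]
  rw [Finset.sum_eq_single κ]
  · rw [HahnSeries.coeff_single_same]
  · intro κ' _ hne
    refine HahnSeries.coeff_single_of_ne fun h => hne ?_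
    have h' : -(κ ∘ σ) = -(κ' ∘ σ) := toLex.injective h
    exact (σ.surjective.injective_comp_right (neg_injective h')).symm
  · intro h
    rw [Finsupp.notMem_support_iff.1 h, HahnSeries.single_eq_zero, HahnSeries.coeff_zero]

variable [DecidableEq I] [∀ i j : I, Fintype (i ⟶ j)]

/-- The contour integral with colours `c` and exponents `d`, as a linear form in the Laurent
polynomial. -/
def kernelForm (c : Fin N → I) (d : Fin N → ℤ) (σ : Fin N ≃ Σ i, Fin (n i)) :
    LaurentPoly (I := I) n →ₗ[GroundField I] GroundField I where
  toFun R := R.coeff.sum fun κ r => r * (kernel c).coeff (toLex (d + κ ∘ σ))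
  map_add' R S := by
    rw [AddMonoidAlgebra.coeff_add, Finsupp.sum_add_index']
    · simp
    · intros
      rw [add_mul]
  map_smul' r R := by
    rw [AddMonoidAlgebra.coeff_smul, Finsupp.sum_smul_index (by simp), Finsupp.sum,
      Finsupp.sum, RingHom.id_apply, smul_eq_mul, Finset.mul_sum]
    exact Finset.sum_congr rfl fun _ _ => mul_assoc _ _ _

theorem kernelForm_apply (c : Fin N → I) (d : Fin N → ℤ) (σ : Fin N ≃ Σ i, Fin (n i))
    (R : LaurentPoly (I := I) n) : kernelForm c d σ R =
      R.coeff.sum fun κ r => r * (kernel c).coeff (toLex (d + κ ∘ σ)) := rfl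

/-- As `d` varies, the forms run through all coefficients of one series. Exponent vectors stand for
inverse monomials, so taking the constant term after multiplying by $z^d$ reads the coefficient at
`d` itself. -/
theorem kernelForm_eq_coeff (c : Fin N → I) (d : Fin N → ℤ) (σ : Fin N ≃ Σ i, Fin (n i))
    (R : LaurentPoly (I := I) n) :
    kernelForm c d σ R = (plugIn σ R * kernel c).coeff (toLex d) := by
  rw [plugIn_eq, kernelForm_apply, Finsupp.sum, Finsupp.sum, Finset.sum_mul, HahnSeries.coeff_sum]
  refine Finset.sum_congr rfl fun κ _ => ?_
  rw [HahnSeries.coeff_single_mul, ← toLex_sub, sub_neg_eq_add]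

theorem contourIntegral_integrand [Fintype I] (w : Fin N → I × ℤ) (σ : Fin N ≃ Σ i, Fin (n i))
    (R : LaurentPoly (I := I) n) :
    contourIntegral (integrand w σ R) =
      kernelForm (fun a => (w a).1) (fun a => (w a).2) σ R := by
  have h : integrand w σ R = HahnSeries.single (toLex (-fun a => (w a).2)) 1 *
      (plugIn σ R * kernel fun a => (w a).1) := by
    rw [integrand, prod_z_zpow, div_eq_mul_inv, mul_assoc, ← Finset.prod_inv_distrib]
    rfl
  rw [contourIntegral, h, HahnSeries.coeff_single_mul, one_mul, kernelForm_eq_coeff, zero_sub,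
    ← toLex_neg, neg_neg]

end Integral

/-! ### Symmetry: independence of the way of plugging in variables. -/

section Symmetric

variable {I : Type*} [Quiver I] {n : I → ℕ}

omit [Quiver I] in
/-- A colour preserving permutation of the variables permutes the variables of each colour. -/
theorem exists_sigmaCongrRight (π : Equiv.Perm (Σ i, Fin (n i))) (hπ : ∀ p, (π p).1 = p.1) :
    ∃ τ : ∀ i, Equiv.Perm (Fin (n i)), π = Equiv.sigmaCongrRight τ := by
  have hcast (p : Σ i, Fin (n i)) (i : I) (h : p.1 = i) :
      (⟨i, Fin.cast (congrArg n h) p.2⟩ : Σ i, Fin (n i)) = p := by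
    subst h
    rfl
  have hπ' (p) : (π.symm p).1 = p.1 := by
    rw [← hπ, Equiv.apply_symm_apply]
  have hinj (i : I) (x y : Fin (n i)) (h : (⟨i, x⟩ : Σ i, Fin (n i)) = ⟨i, y⟩) : x = y := by
    simpa using h
  refine ⟨fun i => ⟨fun x => Fin.cast (congrArg n (hπ ⟨i, x⟩)) (π ⟨i, x⟩).2,
    fun x => Fin.cast (congrArg n (hπ' ⟨i, x⟩)) (π.symm ⟨i, x⟩).2,
    fun x => hinj i _ _ ?_, fun x => hinj i _ _ ?_⟩, ?_⟩
  · have h := hcast _ i (hπ ⟨i, x⟩)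
    exact (hcast _ i (hπ' ⟨i, _⟩)).trans ((congrArg π.symm h).trans (π.symm_apply_apply _))
  · have h := hcast _ i (hπ' ⟨i, x⟩)
    exact (hcast _ i (hπ ⟨i, _⟩)).trans ((congrArg π h).trans (π.apply_symm_apply _))
  · ext1 ⟨i, x⟩
    exact (hcast _ i (hπ ⟨i, x⟩)).symm

theorem symLaurent_coeff_comp (R : symLaurent n) (π : Equiv.Perm (Σ i, Fin (n i)))
    (hπ : ∀ p, (π p).1 = p.1) (κ : (Σ i, Fin (n i)) → ℤ) :
    (R : LaurentPoly n).coeff (κ ∘ π) = (R : LaurentPoly n).coeff κ := by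
  obtain ⟨τ, rfl⟩ := exists_sigmaCongrRight π hπ
  exact R.2 τ κ

variable [DecidableEq I] [∀ i j : I, Fintype (i ⟶ j)] {N : ℕ}

/-- Two ways of plugging in differ by a colour preserving permutation of the variables, under which
`R` is invariant. -/
theorem kernelForm_congr (c : Fin N → I) (d : Fin N → ℤ) {σ σ' : Fin N ≃ Σ i, Fin (n i)}
    (hσ : ∀ a, (σ a).1 = c a) (hσ' : ∀ a, (σ' a).1 = c a) (R : symLaurent n) :
    kernelForm c d σ (R : LaurentPoly n) = kernelForm c d σ' (R : LaurentPoly n) := by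
  set π : Equiv.Perm (Σ i, Fin (n i)) := σ'.symm.trans σ with hπdef
  have hπ (p) : (π p).1 = p.1 := by
    rw [hπdef, Equiv.trans_apply, hσ, ← hσ', Equiv.apply_symm_apply]
  rw [kernelForm_apply, kernelForm_apply]
  refine Finset.sum_equiv (Equiv.arrowCongr π.symm (Equiv.refl ℤ)) (fun κ => ?_) fun κ _ => ?_
  · have : Equiv.arrowCongr π.symm (Equiv.refl ℤ) κ = κ ∘ π := rfl
    rw [this, Finsupp.mem_support_iff, Finsupp.mem_support_iff, symLaurent_coeff_comp R π hπ]
  · have : Equiv.arrowCongr π.symm (Equiv.refl ℤ) κ = κ ∘ π := rfl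
    rw [this, symLaurent_coeff_comp R π hπ]
    have h : (κ ∘ π) ∘ σ' = κ ∘ σ := by
      funext a
      simp [hπdef]
    change _ = _ * (kernel c).coeff (toLex (d + (κ ∘ π) ∘ σ'))
    rw [h]

omit [Quiver I] [∀ i j : I, Fintype (i ⟶ j)] in
theorem hdeg_eq_iff (w : Fin N → I × ℤ) :
    hdeg w = n ↔ ∃ σ : Fin N ≃ Σ i, Fin (n i), ∀ a, (σ a).1 = (w a).1 := by
  constructor
  · rintro rfl
    refine ⟨(Equiv.sigmaFiberEquiv fun a => (w a).1).symm.trans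
      (Equiv.sigmaCongrRight fun i => Fintype.equivFin _), fun a => rfl⟩
  · rintro ⟨σ, hσ⟩
    funext i
    rw [hdeg, ← Fintype.card_fin (n i)]
    exact Fintype.card_congr ((σ.subtypeEquiv fun a => by rw [hσ]).trans (Equiv.sigmaSubtype i))

open Classical in
/-- The linear form on symmetric Laurent polynomials attached to a word. -/
def symForm (w : Fin N → I × ℤ) (n : I → ℕ) : symLaurent n →ₗ[GroundField I] GroundField I :=
  if h : ∃ σ : Fin N ≃ Σ i, Fin (n i), ∀ a, (σ a).1 = (w a).1 then
    kernelForm (fun a => (w a).1) (fun a => (w a).2) h.choose ∘ₗ (symLaurent n).subtype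
  else 0

theorem symForm_eq (w : Fin N → I × ℤ) (σ : Fin N ≃ Σ i, Fin (n i))
    (hσ : ∀ a, (σ a).1 = (w a).1) (R : symLaurent n) :
    symForm w n R = kernelForm (fun a => (w a).1) (fun a => (w a).2) σ (R : LaurentPoly n) := by
  have h : ∃ σ : Fin N ≃ Σ i, Fin (n i), ∀ a, (σ a).1 = (w a).1 := ⟨σ, hσ⟩
  rw [symForm, dif_pos h]
  exact kernelForm_congr _ _ h.choose_spec hσ R

theorem symForm_eq_zero (w : Fin N → I × ℤ)
    (h : ¬ ∃ σ : Fin N ≃ Σ i, Fin (n i), ∀ a, (σ a).1 = (w a).1) :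
    symForm w n = 0 :=
  dif_neg h

variable [Fintype I]

/-- The linear form on the big shuffle algebra attached to a word. -/
def wordForm (w : Fin N → I × ℤ) : BigShuffle I →ₗ[GroundField I] GroundField I :=
  DirectSum.toModule (GroundField I) (I → ℕ) (GroundField I) (symForm w)

theorem wordForm_of (w : Fin N → I × ℤ) (R : symLaurent n) :
    wordForm w (DirectSum.of (fun n => symLaurent n) n R) = symForm w n R :=
  DirectSum.toAddMonoid_of (fun n => (symForm w n).toAddMonoidHom) n R

/-- The pairings of the theorem are those given by `wordForm`. -/
theorem isShufflePairing_iff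
    (P : QuadLoopGroup I →ₗ[GroundField I] BigShuffle I →ₗ[GroundField I] GroundField I) :
    IsShufflePairing P ↔ ∀ (N : ℕ) (w : Fin N → I × ℤ), P (wordElt w) = wordForm w := by
  constructor
  · intro h N w
    refine DirectSum.linearMap_ext _ fun n => LinearMap.ext fun R => ?_
    change P (wordElt w) (DirectSum.of (fun n => symLaurent n) n R) =
      wordForm w (DirectSum.of (fun n => symLaurent n) n R)
    by_cases hw : hdeg w = n
    · obtain ⟨σ, hσ⟩ := (hdeg_eq_iff w).1 hw
      rw [(h N w n R).1 hw σ hσ, wordForm_of, symForm_eq w σ hσ, contourIntegral_integrand]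
    · rw [(h N w n R).2 hw, wordForm_of, symForm_eq_zero w fun hσ => hw ((hdeg_eq_iff w).2 hσ)]
      rfl
  · intro h N w n R
    rw [h]
    refine ⟨fun _ σ hσ => ?_, fun hw => ?_⟩
    · rw [wordForm_of, symForm_eq w σ hσ, contourIntegral_integrand]
    · rw [wordForm_of, symForm_eq_zero w fun hσ => hw ((hdeg_eq_iff w).2 hσ)]
      rfl

end Symmetric

/-! ### Replacing two neighbouring letters, and the pairing on the free algebra. -/

section PairWord

variable {α : Type*} {N : ℕ}

/-- The word `w` with its letters in positions `a` and `b` replaced. -/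
def pairWord (w : Fin N → α) (a b : Fin N) (p p' : α) : Fin N → α :=
  Function.update (Function.update w a p) b p'

theorem ofFn_pairWord (w : Fin N → α) {a b : Fin N} (hab : (a : ℕ) + 1 = b) (p p' : α) :
    List.ofFn (pairWord w a b p p') =
      (List.ofFn w).take a ++ p :: p' :: (List.ofFn w).drop (a + 2) := by
  have hb := b.2
  refine List.ext_getElem ?_ fun m h1 h2 => ?_
  · simp
    omega
  · rw [List.getElem_ofFn]
    simp only [pairWord]
    rw [List.length_ofFn] at h1
    by_cases hmb : m = b
    · subst hmb
      rw [Function.update_self, List.getElem_append_right (by simp; omega)]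
      simp only [List.length_take, List.length_ofFn, min_eq_left a.2.le]
      have : (b : ℕ) - a = 1 := by omega
      simp [this]
    · rw [Function.update_of_ne (by rwa [Ne, Fin.ext_iff])]
      by_cases hma : m = a
      · subst hma
        rw [Function.update_self, List.getElem_append_right (by simp)]
        simp
      · rw [Function.update_of_ne (by rwa [Ne, Fin.ext_iff])]
        rcases lt_or_gt_of_ne hma with h | h
        · rw [List.getElem_append_left (by simp; omega)]
          simp
        · rw [List.getElem_append_right (by simp; omega)]
          obtain ⟨r, hr⟩ : ∃ r, m = a + 2 + r := ⟨m - (a + 2), by omega⟩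
          have : m - a = r + 1 + 1 := by omega
          simp [this, ← hr]

end PairWord

section Pairing

variable {I : Type*} [DecidableEq I] [Quiver I] [∀ i j : I, Fintype (i ⟶ j)] {N : ℕ} {n : I → ℕ}

theorem kernelForm_quadratic (c : Fin N → I) {a b : Fin N} (hab : (a : ℕ) + 1 = b)
    (d : Fin N → ℤ) (k l : ℤ) (σ : Fin N ≃ Σ i, Fin (n i)) (R : LaurentPoly (I := I) n) :
    ((zetaTilde (c b) (c a)).coeff.sum fun m r =>
      r * kernelForm c (d + Pi.single a (k - m + if c a = c b then 1 else 0) +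
        Pi.single b (l + m)) σ R) =
    (-1) ^ (if c a = c b then 1 else 0) * ((zetaTilde (c a) (c b)).coeff.sum fun m r =>
      r * kernelForm (c ∘ Equiv.swap a b) (d ∘ Equiv.swap a b +
        Pi.single a (l - m + if c a = c b then 1 else 0) + Pi.single b (k + m))
        ((Equiv.swap a b).trans σ) R) := by
  simp only [kernelForm_apply, Finsupp.sum, Finset.mul_sum]
  rw [Finset.sum_comm]
  conv_rhs => rw [Finset.sum_comm]
  refine Finset.sum_congr rfl fun κ _ => ?_
  have h := kernel_quadratic c hab (d + κ ∘ σ) k l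
  simp only [Finsupp.sum, Finset.mul_sum] at h
  have h2 := congrArg (fun x => R.coeff κ * x) h
  simp only [Finset.mul_sum] at h2
  have e (u v : Fin N → ℤ) (x y : ℤ) : u + Pi.single a x + Pi.single b y + v =
      u + v + Pi.single a x + Pi.single b y := by abel
  have e' : κ ∘ ((Equiv.swap a b).trans σ) = (κ ∘ σ) ∘ Equiv.swap a b := rfl
  have e'' : d ∘ Equiv.swap a b + (κ ∘ σ) ∘ Equiv.swap a b = (d + κ ∘ σ) ∘ Equiv.swap a b := rfl
  simp only [e, e', e'']
  refine Eq.trans (Finset.sum_congr rfl fun m _ => ?_)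
    (h2.trans (Finset.sum_congr rfl fun m _ => ?_))
  · ring
  · ring

theorem symForm_quadratic (w : Fin N → I × ℤ) {a b : Fin N} (hab : (a : ℕ) + 1 = b)
    (i j : I) (k l : ℤ) (R : symLaurent n) :
    ((zetaTilde j i).coeff.sum fun m r => r *
      symForm (pairWord w a b (i, k - m + if i = j then 1 else 0) (j, l + m)) n R) =
    (-1) ^ (if i = j then 1 else 0) * ((zetaTilde i j).coeff.sum fun m r => r *
      symForm (pairWord w a b (j, l - m + if i = j then 1 else 0) (i, k + m)) n R) := by
  have hne : a ≠ b := by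
    rintro rfl
    omega
  set c : Fin N → I := pairWord (fun x => (w x).1) a b i j with hc
  -- With zeros at `a` and `b`, the two exponents can be added as `Pi.single` terms and `d` is fixed
  -- by the transposition.
  set d : Fin N → ℤ := pairWord (fun x => (w x).2) a b 0 0 with hd
  have hca : c a = i := by simp [hc, pairWord, hne]
  have hcb : c b = j := by simp [hc, pairWord]
  have hfst (i j : I) (x y : ℤ) : (fun e => (pairWord w a b (i, x) (j, y) e).1) =
      pairWord (fun x => (w x).1) a b i j := by
    funext e
    simp only [pairWord, Function.update_apply]
    split_ifs <;> rfl
  have hsnd (i j : I) (x y : ℤ) : (fun e => (pairWord w a b (i, x) (j, y) e).2) =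
      d + Pi.single a x + Pi.single b y := by
    funext e
    simp only [hd, pairWord, Function.update_apply, Pi.add_apply, Pi.single_apply]
    split_ifs <;> simp_all
  have hcs : pairWord (fun x => (w x).1) a b j i = c ∘ Equiv.swap a b := by
    funext e
    simp only [hc, pairWord, Function.update_apply, Function.comp_apply, Equiv.swap_apply_def]
    split_ifs <;> simp_all
  have hds : d ∘ Equiv.swap a b = d := by
    funext e
    simp only [hd, pairWord, Function.update_apply, Function.comp_apply, Equiv.swap_apply_def]
    split_ifs <;> simp_all
  by_cases hσ : ∃ σ : Fin N ≃ Σ i, Fin (n i), ∀ e, (σ e).1 = c e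
  · obtain ⟨σ, hσ⟩ := hσ
    have h := kernelForm_quadratic c hab d k l σ (R : LaurentPoly n)
    rw [hca, hcb, hds] at h
    have e1 (x y : ℤ) : symForm (pairWord w a b (i, x) (j, y)) n R =
        kernelForm c (d + Pi.single a x + Pi.single b y) σ (R : LaurentPoly n) := by
      rw [symForm_eq _ σ, hfst, hsnd]
      intro e
      rw [hσ]
      exact (congrFun (hfst i j x y) e).symm
    have e2 (x y : ℤ) : symForm (pairWord w a b (j, x) (i, y)) n R =
        kernelForm (c ∘ Equiv.swap a b) (d + Pi.single a x + Pi.single b y)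
          ((Equiv.swap a b).trans σ) (R : LaurentPoly n) := by
      rw [symForm_eq _ ((Equiv.swap a b).trans σ), hfst, hsnd, hcs]
      intro e
      rw [Equiv.trans_apply, hσ]
      exact ((congrFun (hfst j i x y) e).trans (congrFun hcs e)).symm
    simp only [e1, e2]
    exact h
  · have e1 (x y : ℤ) : symForm (pairWord w a b (i, x) (j, y)) n R = 0 := by
      rw [symForm_eq_zero, LinearMap.zero_apply]
      rintro ⟨σ, h⟩
      exact hσ ⟨σ, fun e => (h e).trans (congrFun (hfst i j x y) e)⟩
    have e2 (x y : ℤ) : symForm (pairWord w a b (j, x) (i, y)) n R = 0 := by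
      rw [symForm_eq_zero, LinearMap.zero_apply]
      rintro ⟨σ, h⟩
      refine hσ ⟨(Equiv.swap a b).trans σ, fun e => ?_⟩
      rw [Equiv.trans_apply, h]
      refine (congrFun ((hfst j i x y).trans hcs) _).trans ?_
      rw [Function.comp_apply, Equiv.swap_apply_self]
    simp [e1, e2]

variable [Fintype I]

theorem wordForm_quadratic (w : Fin N → I × ℤ) {a b : Fin N} (hab : (a : ℕ) + 1 = b)
    (i j : I) (k l : ℤ) :
    ((zetaTilde j i).coeff.sum fun m r => r •
      wordForm (pairWord w a b (i, k - m + if i = j then 1 else 0) (j, l + m))) =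
    (-1 : GroundField I) ^ (if i = j then 1 else 0) • ((zetaTilde i j).coeff.sum fun m r => r •
      wordForm (pairWord w a b (j, l - m + if i = j then 1 else 0) (i, k + m))) := by
  refine DirectSum.linearMap_ext _ fun n => LinearMap.ext fun R => ?_
  have h := symForm_quadratic w hab i j k l R
  have e (w : Fin N → I × ℤ) : wordForm w
      (DirectSum.lof (GroundField I) (I → ℕ) (fun n => symLaurent n) n R) = symForm w n R :=
    wordForm_of w R
  simp only [Finsupp.sum, LinearMap.comp_apply, LinearMap.sum_apply, LinearMap.smul_apply,
    smul_eq_mul, e] at h ⊢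
  exact h

/-- The linear form attached to a word given as a list. -/
def listForm (l : List (I × ℤ)) : BigShuffle I →ₗ[GroundField I] GroundField I :=
  wordForm (List.equivSigmaTuple l).2

theorem listForm_ofFn (w : Fin N → I × ℤ) : listForm (List.ofFn w) = wordForm w := by
  have h : List.equivSigmaTuple (List.ofFn w) = ⟨N, w⟩ :=
    List.equivSigmaTuple.apply_symm_apply ⟨N, w⟩
  rw [listForm, h]

/-- The pairing on the free algebra. -/
def freeForm : FreeAlgebra (GroundField I) (I × ℤ) →ₗ[GroundField I]
    BigShuffle I →ₗ[GroundField I] GroundField I :=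
  (FreeAlgebra.basisFreeMonoid (GroundField I) (I × ℤ)).constr (GroundField I)
    fun l => listForm (FreeMonoid.toList l)

end Pairing

section FreeWords

variable {I : Type*} [Quiver I]

/-- A word in the free algebra. -/
def freeWord (l : List (I × ℤ)) : FreeAlgebra (GroundField I) (I × ℤ) :=
  (l.map fun p => freeGen p.1 p.2).prod

theorem freeWord_append (l l' : List (I × ℤ)) :
    freeWord (l ++ l') = freeWord l * freeWord l' := by
  simp [freeWord]

theorem freeWord_pair (p p' : I × ℤ) :
    freeWord [p, p'] = freeGen p.1 p.2 * freeGen p'.1 p'.2 := by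
  simp [freeWord]

theorem basisFreeMonoid_apply (l : FreeMonoid (I × ℤ)) :
    FreeAlgebra.basisFreeMonoid (GroundField I) (I × ℤ) l = freeWord (FreeMonoid.toList l) := by
  have h : FreeAlgebra.basisFreeMonoid (GroundField I) (I × ℤ) l =
      MonoidAlgebra.lift (GroundField I) (FreeAlgebra (GroundField I) (I × ℤ)) (FreeMonoid (I × ℤ))
        (FreeMonoid.lift (FreeAlgebra.ι (GroundField I))) (MonoidAlgebra.single l 1) := by
    simp [FreeAlgebra.basisFreeMonoid, FreeAlgebra.equivMonoidAlgebraFreeMonoid]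

  rw [h, MonoidAlgebra.lift_single, one_smul, FreeMonoid.lift_apply]
  rfl

theorem span_freeWord :
    Submodule.span (GroundField I) (Set.range (freeWord (I := I))) = ⊤ := by
  rw [← (FreeAlgebra.basisFreeMonoid (GroundField I) (I × ℤ)).span_eq]
  congr 1
  ext x
  simp only [Set.mem_range, basisFreeMonoid_apply]
  exact FreeMonoid.toList.symm.surjective.exists (p := fun y => freeWord (FreeMonoid.toList y) = x)

end FreeWords

/-! ### Descent to the quotient, uniqueness, and non-degeneracy in `R`. -/

section Existence

variable {I : Type*} [Fintype I] [DecidableEq I] [Quiver I] [∀ i j : I, Fintype (i ⟶ j)]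

theorem freeForm_freeWord (l : List (I × ℤ)) : freeForm (freeWord l) = listForm l := by
  have h := (FreeAlgebra.basisFreeMonoid (GroundField I) (I × ℤ)).constr_basis (GroundField I)
    (fun l => listForm (FreeMonoid.toList l)) (FreeMonoid.ofList l)
  rw [basisFreeMonoid_apply] at h
  exact h

/-- By bilinearity `u` and `v` may be taken to be words; the relation then sits at two neighbouring
positions of a longer word. -/
theorem freeForm_quadRel {x y : FreeAlgebra (GroundField I) (I × ℤ)} (h : QuadRel x y)
    (u v : FreeAlgebra (GroundField I) (I × ℤ)) :
    freeForm (u * x * v) = freeForm (u * y * v) := by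
  have hu : u ∈ Submodule.span (GroundField I) (Set.range (freeWord (I := I))) := by
    rw [span_freeWord]
    trivial
  have hv : v ∈ Submodule.span (GroundField I) (Set.range (freeWord (I := I))) := by
    rw [span_freeWord]
    trivial
  induction hu using Submodule.span_induction with
  | zero => simp
  | add u u' _ _ hu hu' => simp only [add_mul, map_add, hu, hu']
  | smul r u _ hu => simp only [smul_mul_assoc, map_smul, hu]
  | mem u hu =>
    obtain ⟨l₁, rfl⟩ := hu
    induction hv using Submodule.span_induction with
    | zero => simp
    | add u u' _ _ hu hu' => simp only [mul_add, map_add, hu, hu']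
    | smul r u _ hu => simp only [mul_smul_comm, map_smul, hu]
    | mem v hv =>
      obtain ⟨l₂, rfl⟩ := hv
      obtain ⟨i, j, k, l⟩ := h
      -- The exponents 0 are placeholders, since `pairWord` overwrites both letters.
      set w := (l₁ ++ (i, 0) :: (j, 0) :: l₂).get with hw
      have hlen : (l₁ ++ (i, 0) :: (j, 0) :: l₂).length = l₁.length + (l₂.length + 1 + 1) := by
        simp
      set a : Fin (l₁ ++ (i, 0) :: (j, 0) :: l₂).length := ⟨l₁.length, by omega⟩ with ha
      set b : Fin (l₁ ++ (i, 0) :: (j, 0) :: l₂).length := ⟨l₁.length + 1, by omega⟩ with hb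
      have key (p p' : I × ℤ) : freeForm (freeWord l₁ * (freeGen p.1 p.2 * freeGen p'.1 p'.2) *
          freeWord l₂) = wordForm (pairWord w a b p p') := by
        rw [← freeWord_pair, ← freeWord_append, ← freeWord_append, freeForm_freeWord,
          ← listForm_ofFn, ofFn_pairWord w (a := a) (b := b) rfl, hw, List.ofFn_get]
        simp [ha]
      have h := wordForm_quadratic w (a := a) (b := b) rfl i j k l
      simp only [Finsupp.sum, Finset.mul_sum, Finset.sum_mul, mul_smul_comm, smul_mul_assoc,
        map_sum, map_smul, ← key] at h ⊢
      rw [h]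
      by_cases hij : i = j
      · simp only [if_pos hij, pow_one, neg_smul, one_smul, map_neg, map_sum, map_smul]
        exact LinearMap.ext fun S => by simp
      · simp only [if_neg hij, pow_zero, one_smul, map_sum, map_smul]

/-- Equality in the quotient is the equivalence generated by the closure of `QuadRel` under sums and
products. Carrying arbitrary factors `u` and `v` makes the induction over this closure go through.
-/
theorem freeForm_eq_of_mk_eq {x y : FreeAlgebra (GroundField I) (I × ℤ)}
    (h : RingQuot.mkAlgHom (GroundField I) QuadRel x = RingQuot.mkAlgHom (GroundField I) QuadRel y) :
    freeForm x = freeForm y := by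
  have hrel (x y) (h : RingQuot.Rel (QuadRel (I := I)) x y) (u v) :
      freeForm (u * x * v) = freeForm (u * y * v) := by
    induction h generalizing u v with
    | of h => exact freeForm_quadRel h u v
    | add_left _ ih => simp only [mul_add, add_mul, map_add, ih]
    | mul_left _ ih =>
      rename_i a b c _
      rw [← mul_assoc u, mul_assoc (u * a), ih, ← mul_assoc u, mul_assoc (u * b)]
    | mul_right _ ih => rw [← mul_assoc u, ← mul_assoc u, ih]
  have h' : Quot.mk (RingQuot.Rel QuadRel) x = Quot.mk (RingQuot.Rel QuadRel) y := by
    simpa [RingQuot.mkAlgHom, RingQuot.mkRingHom] using h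
  have hE := Quot.eqvGen_exact h'
  clear h h'
  induction hE with
  | rel x y h => simpa using hrel x y h 1 1
  | refl => rfl
  | symm _ _ _ ih => exact ih.symm
  | trans _ _ _ _ _ h1 h2 => exact h1.trans h2

omit [Fintype I] in
/-- The image of a word of the free algebra in the quadratic quantum loop group. -/
theorem mk_freeWord_ofFn {N : ℕ} (w : Fin N → I × ℤ) :
    RingQuot.mkAlgHom (GroundField I) QuadRel (freeWord (List.ofFn w)) = wordElt w := by
  rw [freeWord, map_list_prod, List.map_map, List.map_ofFn]
  rfl

omit [Fintype I] in
theorem span_wordElt :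
    Submodule.span (GroundField I)
      (Set.range fun w : Σ N, Fin N → I × ℤ => wordElt w.2) = ⊤ := by
  have h := congrArg (Submodule.map
    (RingQuot.mkAlgHom (GroundField I) (QuadRel (I := I))).toLinearMap) (span_freeWord (I := I))
  rw [Submodule.map_span, Submodule.map_top, LinearMap.range_eq_top.2
    (RingQuot.mkAlgHom_surjective (GroundField I) QuadRel)] at h
  rw [← h, ← Set.range_comp]
  congr 1
  refine (List.equivSigmaTuple.surjective.range_comp _).symm.trans (congrArg Set.range ?_)
  funext l
  simp only [Function.comp_apply]
  rw [← mk_freeWord_ofFn]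
  have h2 : List.ofFn (List.equivSigmaTuple l).2 = l := List.equivSigmaTuple.symm_apply_apply l
  rw [h2]
  rfl

theorem existsUnique_shufflePairing :
    ∃! P : QuadLoopGroup I →ₗ[GroundField I] BigShuffle I →ₗ[GroundField I] GroundField I,
      IsShufflePairing P := by
  -- A linear section of the quotient map suffices: the free form takes the same value on all lifts
  -- of an element.
  obtain ⟨g, hg⟩ := LinearMap.exists_rightInverse_of_surjective
    (RingQuot.mkAlgHom (GroundField I) (QuadRel (I := I))).toLinearMap
    (LinearMap.range_eq_top.2 (RingQuot.mkAlgHom_surjective (GroundField I) QuadRel))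
  refine ⟨freeForm ∘ₗ g, (isShufflePairing_iff _).2 fun N w => ?_, fun P hP => ?_⟩
  · rw [LinearMap.comp_apply, ← listForm_ofFn, ← freeForm_freeWord]
    refine freeForm_eq_of_mk_eq ?_
    rw [mk_freeWord_ofFn]
    exact LinearMap.congr_fun hg _
  · replace hP := (isShufflePairing_iff P).1 hP
    refine LinearMap.ext_on span_wordElt ?_
    rintro _ ⟨⟨N, w⟩, rfl⟩
    rw [hP, LinearMap.comp_apply, ← listForm_ofFn, ← freeForm_freeWord]
    refine freeForm_eq_of_mk_eq ?_
    rw [mk_freeWord_ofFn]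
    exact (LinearMap.congr_fun hg _).symm

/-- Words with the colours of the variables of degree `n` and arbitrary exponents see every
coefficient of $R_n$ times the kernel. The product is therefore zero in a field, while the kernel is
not. -/
theorem separatingRight_of_isShufflePairing
    {P : QuadLoopGroup I →ₗ[GroundField I] BigShuffle I →ₗ[GroundField I] GroundField I}
    (hP : IsShufflePairing P) : P.SeparatingRight := by
  rw [isShufflePairing_iff] at hP
  intro R hR
  refine DFinsupp.ext fun n => Subtype.ext ?_
  set N := Fintype.card (Σ i, Fin (n i))
  set σ : Fin N ≃ Σ i, Fin (n i) := (Fintype.equivFin _).symm with hσdef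
  have key (d : Fin N → ℤ) :
      kernelForm (fun a => (σ a).1) d σ ((R n : symLaurent n) : LaurentPoly n) = 0 := by
    set w : Fin N → I × ℤ := fun a => ((σ a).1, d a) with hw
    have h (S : BigShuffle I) : wordForm w S = symForm w n (S n) := by
      induction S using DirectSum.induction_on with
      | zero => simp
      | of m S =>
        rw [wordForm_of]
        by_cases hm : m = n
        · subst hm
          rw [DirectSum.of_eq_same]
        · rw [DirectSum.of_eq_of_ne _ _ _ (Ne.symm hm), map_zero, symForm_eq_zero,
            LinearMap.zero_apply]
          intro h
          rw [← hdeg_eq_iff] at h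
          exact hm (h.symm.trans ((hdeg_eq_iff w).2 ⟨σ, fun _ => rfl⟩))
      | add S T hS hT => rw [map_add, hS, hT, DirectSum.add_apply, map_add]
    rw [← symForm_eq w σ (fun _ => rfl), ← h, ← hP, hR]
  have h0 : plugIn σ ((R n : symLaurent n) : LaurentPoly n) * kernel (fun a => (σ a).1) = 0 := by
    ext v
    rw [← toLex_ofLex v, ← kernelForm_eq_coeff, key, HahnSeries.coeff_zero]
  have h1 := (mul_eq_zero.1 h0).resolve_right (hasOrd_kernel _).1
  refine AddMonoidAlgebra.ext (Finsupp.ext fun κ => ?_)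
  rw [← coeff_plugIn σ, h1]
  rfl

end Existence

/-! ### The range of exponents of $\widetilde\zeta$. -/

section Support

variable {K : Type*} [Field K]

/-- The Laurent polynomial `p` has exponents between `lo` and `hi`, and `lo` occurs. -/
def HasRange (p : LaurentPolynomial K) (lo hi : ℤ) : Prop :=
  (∀ m, p.coeff m ≠ 0 → lo ≤ m ∧ m ≤ hi) ∧ p.coeff lo ≠ 0

theorem HasRange.mul {p r : LaurentPolynomial K} {lo hi lo' hi' : ℤ} (hp : HasRange p lo hi)
    (hr : HasRange r lo' hi') : HasRange (p * r) (lo + lo') (hi + hi') := by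
  constructor
  · intro m hm
    have h := AddMonoidAlgebra.support_coeff_mul_subset p r (Finsupp.mem_support_iff.2 hm)
    obtain ⟨u, hu, v, hv, rfl⟩ := Finset.mem_add.1 h
    have h1 := hp.1 u (Finsupp.mem_support_iff.1 hu)
    have h2 := hr.1 v (Finsupp.mem_support_iff.1 hv)
    omega
  · rw [AddMonoidAlgebra.coeff_mul_add_of_uniqueAdd]
    · exact mul_ne_zero hp.2 hr.2
    · intro u v hu hv huv
      have h1 := hp.1 u (Finsupp.mem_support_iff.1 hu)
      have h2 := hr.1 v (Finsupp.mem_support_iff.1 hv)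
      omega

theorem HasRange.one : HasRange (1 : LaurentPolynomial K) 0 0 := by
  have h (m : ℤ) : (1 : LaurentPolynomial K).coeff m = if m = 0 then 1 else 0 := by
    rw [← map_one (C (R := K)), C_apply]
  refine ⟨fun m hm => ?_, ?_⟩
  · rw [h] at hm
    simp_all
  · simp [h]

theorem HasRange.prod {ι : Type*} (s : Finset ι) {f : ι → LaurentPolynomial K} {lo hi : ℤ}
    (h : ∀ i ∈ s, HasRange (f i) lo hi) :
    HasRange (∏ i ∈ s, f i) (s.card * lo) (s.card * hi) := by
  induction s using Finset.cons_induction with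
  | empty => simpa using HasRange.one
  | cons a s ha ih =>
    rw [Finset.prod_cons, Finset.card_cons]
    convert (h a (Finset.mem_cons_self a s)).mul
      (ih fun i hi => h i (Finset.mem_cons_of_mem hi)) using 1 <;> push_cast <;> ring

theorem hasRange_add {u v : ℤ} (huv : u < v) {a : K} (ha : a ≠ 0) (b : K) :
    HasRange (C a * T u - C b * T v) u v := by
  have h (m : ℤ) : (C a * T u - C b * T v).coeff m =
      (if u = m then a else 0) - if v = m then b else 0 := by
    rw [AddMonoidAlgebra.coeff_sub, ← single_eq_C_mul_T, ← single_eq_C_mul_T,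
      AddMonoidAlgebra.coeff_single, AddMonoidAlgebra.coeff_single, Finsupp.sub_apply,
      Finsupp.single_apply, Finsupp.single_apply]
  refine ⟨fun m hm => ?_, ?_⟩
  · rw [h] at hm
    by_cases h1 : u = m
    · omega
    · by_cases h2 : v = m
      · omega
      · simp [h1, h2] at hm
  · rw [h, if_pos rfl, if_neg huv.ne', sub_zero]
    exact ha

end Support

section ZetaTilde

variable {I : Type*} [DecidableEq I] [Quiver I] [∀ i j : I, Fintype (i ⟶ j)]

theorem hasRange_zetaTilde (i j : I) :
    HasRange (zetaTilde i j) (-arrows j i)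
      ((if i = j then 1 else 0) + arrows i j) := by
  have h1 : HasRange ((1 - C (q I)⁻¹ * T 1 : LaurentPolynomial (GroundField I)) ^
      (if i = j then 1 else 0)) 0 (if i = j then 1 else 0) := by
    split_ifs
    · have := hasRange_add (K := GroundField I) zero_lt_one one_ne_zero (q I)⁻¹
      rwa [map_one, T_zero, one_mul, ← pow_one (1 - _)] at this
    · exact HasRange.one
  have h2 : HasRange (∏ e : i ⟶ j, (C (1 / t e) - T 1 : LaurentPolynomial (GroundField I))) 0
      (arrows i j) := by
    have := HasRange.prod (Finset.univ : Finset (i ⟶ j))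
      (f := fun e => (C (1 / t e) - T 1 : LaurentPolynomial (GroundField I))) (lo := 0) (hi := 1)
      fun e _ => by
        have := hasRange_add zero_lt_one (one_div_ne_zero (t_ne_zero e)) 1
        rwa [map_one, T_zero, one_mul, mul_one] at this
    simpa [arrows] using this
  have h3 : HasRange (∏ e : j ⟶ i, (1 - C (t e / q I) * T (-1) :
      LaurentPolynomial (GroundField I))) (-arrows j i) 0 := by
    have := HasRange.prod (Finset.univ : Finset (j ⟶ i))
      (f := fun e => (1 - C (t e / q I) * T (-1) : LaurentPolynomial (GroundField I)))
      (lo := -1) (hi := 0) fun e _ => by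
        have := hasRange_add (u := -1) (v := 0) (by norm_num)
          (neg_ne_zero.2 (div_ne_zero (t_ne_zero e) q_ne_zero)) (-1)
        rw [map_neg, map_neg, map_one, T_zero, mul_one] at this
        convert this using 1
        ring
    simpa [arrows] using this
  convert (h1.mul h2).mul h3 using 1
  · rfl
  · rw [zero_add, zero_add]
  · rw [add_zero]

end ZetaTilde

/-! ### The quadratic relation in corrected exponents. -/

section WordRelation

variable {I : Type*} [DecidableEq I] [Quiver I] [∀ i j : I, Fintype (i ⟶ j)] {N : ℕ}

theorem gen_quadratic (i j : I) (k l : ℤ) :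
    ((zetaTilde j i).coeff.sum fun m r =>
      r • (gen i (k - m + if i = j then 1 else 0) * gen j (l + m))) =
    (-1 : GroundField I) ^ (if i = j then 1 else 0) • ((zetaTilde i j).coeff.sum fun m r =>
      r • (gen j (l - m + if i = j then 1 else 0) * gen i (k + m))) := by
  have h := RingQuot.mkAlgHom_rel (GroundField I) (QuadRel.quad i j k l)
  have hg (i : I) (d : ℤ) : RingQuot.mkAlgHom (GroundField I) QuadRel (freeGen i d) = gen i d := rfl
  simp only [Finsupp.sum, map_sum, map_smul, map_mul, hg] at h
  simp only [Finsupp.sum]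
  rw [h]
  by_cases hij : i = j
  · simp only [if_pos hij, pow_one, neg_smul, one_smul, map_neg, map_sum, map_smul, map_mul, hg]
    exact (neg_one_smul (GroundField I) _).symm
  · simp [hij, hg]

theorem wordElt_pairWord (w : Fin N → I × ℤ) {a b : Fin N} (hab : (a : ℕ) + 1 = b)
    (p p' : I × ℤ) : wordElt (pairWord w a b p p') =
      (((List.ofFn w).take a).map fun p => gen p.1 p.2).prod *
        (gen p.1 p.2 * gen p'.1 p'.2) *
        (((List.ofFn w).drop (a + 2)).map fun p => gen p.1 p.2).prod := by
  have h (v : Fin N → I × ℤ) : wordElt v = ((List.ofFn v).map fun p => gen p.1 p.2).prod := by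
    rw [List.map_ofFn]
    rfl
  rw [h, ofFn_pairWord w hab]
  simp [mul_assoc]

theorem wordElt_quadratic (w : Fin N → I × ℤ) {a b : Fin N} (hab : (a : ℕ) + 1 = b)
    (i j : I) (k l : ℤ) :
    ((zetaTilde j i).coeff.sum fun m r => r •
      wordElt (pairWord w a b (i, k - m + if i = j then 1 else 0) (j, l + m))) =
    (-1 : GroundField I) ^ (if i = j then 1 else 0) • ((zetaTilde i j).coeff.sum fun m r => r •
      wordElt (pairWord w a b (j, l - m + if i = j then 1 else 0) (i, k + m))) := by
  have h := congrArg (fun x => (((List.ofFn w).take a).map fun p => gen p.1 p.2).prod * x *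
    (((List.ofFn w).drop (a + 2)).map fun p => gen p.1 p.2).prod) (gen_quadratic i j k l)
  simpa only [wordElt_pairWord w hab, Finsupp.sum, Finset.mul_sum, Finset.sum_mul, mul_smul_comm,
    smul_mul_assoc] using h

-- The transposition permutes all summands of `shift` but the one of the pair `(a, b)`, which
-- changes direction and arrow count; this is the whole correction.
omit [DecidableEq I] in
theorem shift_swap (c : Fin N → I) {a b : Fin N} (hab : (a : ℕ) + 1 = b) (x : Fin N) :
    shift (c ∘ Equiv.swap a b) (Equiv.swap a b x) = shift c x -
      (arrows (c a) (c b) + arrows (c b) (c a)) * rootVec a b x := by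
  set s := Equiv.swap a b with hs
  have hlt : a < b := by
    rw [Fin.lt_def]
    omega
  have hsum (c : Fin N → I) (y : Fin N) : shift c y = arrows (c a) (c b) * rootVec a b y +
      ∑ p ∈ (pairs N).erase (a, b), arrows (c p.1) (c p.2) * rootVec p.1 p.2 y := by
    have := Finset.add_sum_erase (pairs N)
      (fun p => arrows (c p.1) (c p.2) * rootVec p.1 p.2 y)
      (a := (a, b)) (mem_pairs.2 hlt)
    rw [this, shift, Finset.sum_apply]
    rfl
  have h := sum_pairs_erase_swap hab fun p : Fin N × Fin N =>
    arrows ((c ∘ s) p.1) ((c ∘ s) p.2) * rootVec p.1 p.2 (s x)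
  have hr (u v y : Fin N) : rootVec (s u) (s v) (s y) = rootVec u v y :=
    congrFun (rootVec_comp s u v) y
  have hss (y : Fin N) : s (s y) = y := Equiv.swap_apply_self a b y
  have hab' : rootVec a b (s x) = -rootVec a b x := by
    rw [← hr, hss, hs, Equiv.swap_apply_left, Equiv.swap_apply_right]
    simp [rootVec]
  rw [hsum, ← h, hsum c]
  simp only [← hs, hr, Function.comp_apply, hss, hab']
  have e1 : s a = b := Equiv.swap_apply_left a b
  have e2 : s b = a := Equiv.swap_apply_right a b
  rw [e1, e2]
  ring

/-- The element of the quadratic quantum loop group attached to a word whose exponents are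
corrected by the leading exponents of the kernel. -/
def shiftedElt (W : Fin N → I × ℤ) : QuadLoopGroup I :=
  wordElt fun e => ((W e).1, (W e).2 + shift (fun x => (W x).1) e)

/-- After the correction, the lowest exponent of each $\widetilde\zeta$ gives $[i^{(x)}j^{(y)}]$ on
the left and $[j^{(y+\delta)}i^{(x-\delta)}]$ on the right. -/
theorem shiftedElt_quadratic (W : Fin N → I × ℤ) {a b : Fin N} (hab : (a : ℕ) + 1 = b)
    (i j : I) (x y : ℤ) :
    ((zetaTilde j i).coeff.sum fun m r => r •
      shiftedElt (pairWord W a b (i, x - (m + arrows i j))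
        (j, y + (m + arrows i j)))) =
    (-1 : GroundField I) ^ (if i = j then 1 else 0) • ((zetaTilde i j).coeff.sum fun m r => r •
      shiftedElt (pairWord W a b
        (j, y + (if i = j then 1 else 0) - (m + arrows j i))
        (i, x - (if i = j then 1 else 0) + (m + arrows j i)))) := by
  have hne : a ≠ b := by
    rintro rfl
    omega
  set c : Fin N → I := pairWord (fun e => (W e).1) a b i j with hc
  have hca : c a = i := by simp [hc, pairWord, hne]
  have hcb : c b = j := by simp [hc, pairWord]
  have hcs : pairWord (fun e => (W e).1) a b j i = c ∘ Equiv.swap a b := by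
    funext e
    simp only [hc, pairWord, Function.update_apply, Function.comp_apply, Equiv.swap_apply_def]
    split_ifs <;> simp_all
  set S := shift c with hS
  have hshift := shift_swap c hab
  rw [hca, hcb, ← hS] at hshift
  have hsa := hshift b
  have hsb := hshift a
  rw [Equiv.swap_apply_right] at hsa
  rw [Equiv.swap_apply_left] at hsb
  have hra : rootVec a b a = 1 := by simp [rootVec, hne]
  have hrb : rootVec a b b = -1 := by simp [rootVec, hne.symm]
  rw [hrb] at hsa
  rw [hra] at hsb
  have hsx (e : Fin N) (h1 : e ≠ a) (h2 : e ≠ b) : shift (c ∘ Equiv.swap a b) e = S e := by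
    have := hshift e
    rw [Equiv.swap_apply_of_ne_of_ne h1 h2] at this
    rw [this]
    simp [rootVec, h1, h2]
  set w : Fin N → I × ℤ := fun e => ((W e).1, (W e).2 + S e) with hw
  have hfst (i j : I) (x y : ℤ) : (fun e => (pairWord W a b (i, x) (j, y) e).1) =
      pairWord (fun e => (W e).1) a b i j := by
    funext e
    simp only [pairWord, Function.update_apply]
    split_ifs <;> rfl
  have e1 (x y : ℤ) : shiftedElt (pairWord W a b (i, x) (j, y)) =
      wordElt (pairWord w a b (i, x + S a) (j, y + S b)) := by
    rw [shiftedElt, hfst, ← hc, ← hS]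
    congr 1
    funext e
    simp only [pairWord, Function.update_apply]
    split_ifs <;> simp_all
  have e2 (x y : ℤ) : shiftedElt (pairWord W a b (j, x) (i, y)) =
      wordElt (pairWord w a b
        (j, x + S b + (arrows i j + arrows j i))
        (i, y + S a - (arrows i j + arrows j i))) := by
    rw [shiftedElt, hfst, hcs]
    congr 1
    funext e
    by_cases hb : e = b
    · subst hb
      simp only [pairWord, Function.update_self, hsb]
      congr 1
      ring
    · by_cases ha : e = a
      · subst ha
        simp only [pairWord, Function.update_self, Function.update_of_ne hb, hsa]
        congr 1
        ring
      · simp only [pairWord, Function.update_of_ne hb, Function.update_of_ne ha, hsx e ha hb, hw]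
  -- These values of `k` and `l` make the term $m=-\#\{i\to j\}$ on the left the uncorrected word
  -- with exponents `x + S a` and `y + S b`.
  have h := wordElt_quadratic w hab i j
    (x + S a - arrows i j - if i = j then 1 else 0) (y + S b + arrows i j)
  simp only [e1, e2]
  refine Eq.trans (Finsupp.sum_congr fun m _ => ?_)
    (h.trans (congrArg _ (Finsupp.sum_congr fun m _ => ?_)))
  · exact congrArg₂ (fun u v => (zetaTilde j i).coeff m • wordElt (pairWord w a b (i, u) (j, v)))
      (by ring) (by ring)
  · exact congrArg₂ (fun u v => (zetaTilde i j).coeff m • wordElt (pairWord w a b (j, u) (i, v)))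
      (by ring) (by ring)

end WordRelation

/-! ### Straightening: sorted words span. -/

section Straightening

/-- Isolates the extreme term of a relation modulo the span of smaller words. -/
theorem finsupp_sum_sub_mem {R M : Type*} [Ring R] [AddCommGroup M] [Module R M]
    (S : Submodule R M) (c : ℤ →₀ R) (f : ℤ → M) (m₀ : ℤ) (h₀ : c m₀ ≠ 0)
    (h : ∀ m, c m ≠ 0 → m ≠ m₀ → f m ∈ S) :
    (c.sum fun m r => r • f m) - c m₀ • f m₀ ∈ S := by
  rw [Finsupp.sum, ← Finset.add_sum_erase _ _ (Finsupp.mem_support_iff.2 h₀), add_sub_cancel_left]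
  refine S.sum_mem fun m hm => S.smul_mem _ ?_
  rw [Finset.mem_erase, Finsupp.mem_support_iff] at hm
  exact h m hm.2 hm.1

variable {I : Type*} [Fintype I]

/-- Letters, ordered by exponent first. -/
def code (p : I × ℤ) : ℤ ×ₗ Fin (Fintype.card I) :=
  toLex (p.2, Fintype.equivFin I p.1)

theorem code_injective : Function.Injective (code (I := I)) := by
  rintro ⟨i, x⟩ ⟨j, y⟩ h
  have h' := toLex.injective h
  simpa [and_comm] using h'

theorem code_lt {i j : I} {x y : ℤ} :
    code (i, x) < code (j, y) ↔
      x < y ∨ x = y ∧ Fintype.equivFin I i < Fintype.equivFin I j := by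
  rw [code, code, Prod.Lex.toLex_lt_toLex]

variable {N : ℕ}

/-- Words, ordered lexicographically. -/
def wordCode (W : Fin N → I × ℤ) : Lex (Fin N → ℤ ×ₗ Fin (Fintype.card I)) :=
  toLex fun e => code (W e)

theorem wordCode_pairWord_lt (W : Fin N → I × ℤ) {a b : Fin N} (hab : a < b) {p p' : I × ℤ}
    (h : code p < code (W a)) : wordCode (pairWord W a b p p') < wordCode W := by
  refine ⟨a, fun e he => ?_, ?_⟩
  · have h1 : e ≠ a := he.ne
    have h2 : e ≠ b := (he.trans hab).ne
    change code (pairWord W a b p p' e) = code (W e)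
    simp only [pairWord, Function.update_of_ne h1, Function.update_of_ne h2]
  · change code (pairWord W a b p p' a) < code (W a)
    simpa only [pairWord, Function.update_of_ne hab.ne, Function.update_self] using h

/-- The energy of a word, with respect to exponents corrected by multiples of the position. -/
def energy (B : ℤ) (W : Fin N → I × ℤ) : ℤ :=
  ∑ e, ((W e).2 - e * B) ^ 2

/-- The lexicographic order on integer words is not well-founded; this finiteness is what makes
descent terminate. -/
theorem finite_energy_le (B K : ℤ) : {W : Fin N → I × ℤ | energy B W ≤ K}.Finite := by
  have hfin (e : Fin N) :
      ((Set.univ : Set I) ×ˢ Set.Icc (e * B - K) (e * B + K)).Finite :=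
    Set.finite_univ.prod (Set.finite_Icc _ _)
  refine (Set.Finite.pi' hfin).subset fun W hW e => ?_
  have h1 : ((W e).2 - e * B) ^ 2 ≤ K :=
    (Finset.single_le_sum (f := fun e : Fin N => ((W e).2 - e * B) ^ 2)
      (fun _ _ => sq_nonneg _) (Finset.mem_univ e)).trans hW
  -- An integer and its negative are at most its square, hence at most `K`.
  have h2 := Int.le_self_sq ((W e).2 - e * B)
  have h3 := Int.le_self_sq (-((W e).2 - e * B))
  rw [neg_sq] at h3
  refine ⟨trivial, ?_, ?_⟩
  · linarith
  · linarith

-- With a fixed sum of the two exponents, the energy is a convex quadratic in the first one, taking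
-- equal values at $x$ and $y-B$, where $x,y$ are the old exponents. It does not increase between
-- these points. The offset `B` leaves room for the width of the relation.
omit [Fintype I] in
theorem energy_pairWord_le (B : ℤ) (W : Fin N → I × ℤ) {a b : Fin N} (hab : (a : ℕ) + 1 = b)
    {p p' : I × ℤ} (hsum : p.2 + p'.2 = (W a).2 + (W b).2) (h1 : (W b).2 - B ≤ p.2)
    (h2 : p.2 ≤ (W a).2) : energy B (pairWord W a b p p') ≤ energy B W := by
  have hne : b ≠ a := by
    rintro rfl
    omega
  have hb : b ∈ Finset.univ.erase a := Finset.mem_erase.2 ⟨hne, Finset.mem_univ b⟩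
  have hb' : ((b : ℕ) : ℤ) = a + 1 := by
    rw [← hab]
    push_cast
    ring
  have hsplit (V : Fin N → I × ℤ) : energy B V = ((V a).2 - a * B) ^ 2 +
      (((V b).2 - b * B) ^ 2 + ∑ e ∈ (Finset.univ.erase a).erase b, ((V e).2 - e * B) ^ 2) := by
    rw [energy, Finset.add_sum_erase _ (fun e : Fin N => ((V e).2 - e * B) ^ 2) hb,
      Finset.add_sum_erase _ (fun e : Fin N => ((V e).2 - e * B) ^ 2) (Finset.mem_univ a)]
  have hrest : ∑ e ∈ (Finset.univ.erase a).erase b, ((pairWord W a b p p' e).2 - e * B) ^ 2 =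
      ∑ e ∈ (Finset.univ.erase a).erase b, ((W e).2 - e * B) ^ 2 := by
    refine Finset.sum_congr rfl fun e he => ?_
    rw [Finset.mem_erase, Finset.mem_erase] at he
    simp only [pairWord, Function.update_of_ne he.1, Function.update_of_ne he.2.1]
  have ha : pairWord W a b p p' a = p := by
    simp only [pairWord, Function.update_of_ne hne.symm, Function.update_self]
  have hb2 : pairWord W a b p p' b = p' := by
    simp only [pairWord, Function.update_self]
  rw [hsplit, hsplit W, hrest, ha, hb2, hb', ← sub_nonneg]
  have h3 : p'.2 = (W a).2 + (W b).2 - p.2 := by linarith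
  rw [h3]
  -- The energy drops by exactly twice this product.
  have := mul_nonneg (sub_nonneg.2 h1) (sub_nonneg.2 h2)
  nlinarith

variable [DecidableEq I] [Quiver I] [∀ i j : I, Fintype (i ⟶ j)]

/-- The span of the elements attached to sorted words. -/
def sortedSpan (I : Type*) [Fintype I] [DecidableEq I] [Quiver I] [∀ i j : I, Fintype (i ⟶ j)] :
    Submodule (GroundField I) (QuadLoopGroup I) :=
  Submodule.span (GroundField I) {x | ∃ (N : ℕ) (W : Fin N → I × ℤ),
    Monotone (fun e => code (W e)) ∧ shiftedElt W = x}

/-- Twice the number of all arrows. -/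
def arrowBound (I : Type*) [Fintype I] [Quiver I] [∀ i j : I, Fintype (i ⟶ j)] : ℤ :=
  2 * ∑ p : I × I, arrows p.1 p.2

omit [Fintype I] [DecidableEq I] in
theorem arrows_nonneg (i j : I) : 0 ≤ arrows i j :=
  Int.natCast_nonneg _

omit [DecidableEq I] in
theorem arrows_add_le (i j : I) : arrows i j + arrows j i ≤ arrowBound I := by
  have h (i j : I) : arrows i j ≤ ∑ p : I × I, arrows p.1 p.2 :=
    Finset.single_le_sum (f := fun p : I × I => arrows p.1 p.2)
      (fun p _ => arrows_nonneg p.1 p.2) (Finset.mem_univ (i, j))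
  rw [arrowBound]
  linarith [h i j, h j i]

/-- One step of the straightening of words. -/
theorem shiftedElt_mem_of_inversion (W : Fin N → I × ℤ) {a b : Fin N} (hab : (a : ℕ) + 1 = b)
    (hinv : code (W b) < code (W a)) (S : Submodule (GroundField I) (QuadLoopGroup I))
    (hS : ∀ V : Fin N → I × ℤ, energy (arrowBound I) V ≤ energy (arrowBound I) W →
      wordCode V < wordCode W → shiftedElt V ∈ S) : shiftedElt W ∈ S := by
  obtain ⟨i, x, hi⟩ : ∃ i x, W a = (i, x) := ⟨_, _, rfl⟩
  obtain ⟨j, y, hj⟩ : ∃ j y, W b = (j, y) := ⟨_, _, rfl⟩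
  have hlt : a < b := by
    rw [Fin.lt_def]
    omega
  have hself : pairWord W a b (i, x) (j, y) = W := by
    rw [pairWord, ← hi, ← hj, Function.update_eq_self, Function.update_eq_self]
  have hstep (p p' : I × ℤ) (hsum : p.2 + p'.2 = x + y) (h1 : y - arrowBound I ≤ p.2)
      (h2 : p.2 ≤ x) (h3 : code p < code (i, x)) : shiftedElt (pairWord W a b p p') ∈ S := by
    refine hS _ (energy_pairWord_le _ W hab ?_ ?_ ?_) (wordCode_pairWord_lt W hlt (hi ▸ h3))
    · rw [hi, hj]
      exact hsum
    · rw [hj]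
      exact h1
    · rw [hi]
      exact h2
  have hA := arrows_add_le i j
  have h0 := arrows_nonneg i j
  have h0' := arrows_nonneg j i
  rw [hi, hj, code_lt] at hinv
  -- For equal colours an inversion is strict in the exponents, which absorbs the extra $\delta$.
  have hxy : y + (if i = j then 1 else 0) ≤ x := by
    by_cases h : i = j
    · subst h
      rw [if_pos rfl]
      rcases hinv with h | h
      · omega
      · exact absurd h.2 (lt_irrefl _)
    · rw [if_neg h]
      rcases hinv with h | h <;> omega
  have hR1 := hasRange_zetaTilde j i
  have hR2 := hasRange_zetaTilde i j
  have hδ : (if j = i then (1 : ℤ) else 0) = if i = j then 1 else 0 := by simp only [eq_comm]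
  rw [hδ] at hR1
  have hδ0 : (0 : ℤ) ≤ if i = j then 1 else 0 := by split_ifs <;> norm_num
  have hrel := shiftedElt_quadratic W hab i j x y
  have hL := finsupp_sum_sub_mem S (zetaTilde j i).coeff
    (fun m => shiftedElt (pairWord W a b (i, x - (m + arrows i j)) (j, y + (m + arrows i j))))
    (-arrows i j) hR1.2 fun m hm hne => by
      have := hR1.1 m hm
      have hm' : -arrows i j < m := lt_of_le_of_ne this.1 (Ne.symm hne)
      refine hstep _ _ (by ring) ?_ ?_ (code_lt.2 (Or.inl ?_))
      · change y - arrowBound I ≤ x - (m + arrows i j)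
        linarith [this.2]
      · change x - (m + arrows i j) ≤ x
        linarith
      · linarith
  have hR := finsupp_sum_sub_mem S (zetaTilde i j).coeff
    (fun m => shiftedElt (pairWord W a b (j, y + (if i = j then 1 else 0) - (m + arrows j i))
        (i, x - (if i = j then 1 else 0) + (m + arrows j i))))
    (-arrows j i) hR2.2 fun m hm hne => by
      have := hR2.1 m hm
      have hm' : -arrows j i < m := lt_of_le_of_ne this.1 (Ne.symm hne)
      refine hstep _ _ (by ring) ?_ ?_ (code_lt.2 (Or.inl ?_))
      · change y - arrowBound I ≤ y + (if i = j then 1 else 0) - (m + arrows j i)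
        linarith [this.2]
      · change y + (if i = j then 1 else 0) - (m + arrows j i) ≤ x
        linarith
      · linarith
  simp only [neg_add_cancel, add_zero, sub_zero, hself] at hL hR
  rw [hrel] at hL
  -- In this case the extreme term on the right is again `W`, with the opposite sign after moving it
  -- over. The two copies add up to twice a nonzero coefficient, and the characteristic is zero.
  by_cases hex : i = j ∧ x = y + 1
  · obtain ⟨rfl, rfl⟩ := hex
    simp only [if_true, pow_one, add_sub_cancel_right, hself] at hL hR
    have h := S.add_mem hL hR
    have h2 : ((2 : GroundField I) * (zetaTilde i i).coeff (-arrows i i)) • shiftedElt W ∈ S := by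
      convert S.neg_mem h using 1
      module
    exact (S.smul_mem_iff (mul_ne_zero two_ne_zero hR1.2)).1 h2
  · have hlast : shiftedElt (pairWord W a b (j, y + if i = j then 1 else 0)
        (i, x - if i = j then 1 else 0)) ∈ S := by
      refine hstep _ _ (by ring) ?_ hxy (code_lt.2 ?_)
      · change y - arrowBound I ≤ y + if i = j then 1 else 0
        linarith
      · by_cases h : i = j
        · subst h
          rw [if_pos rfl] at hxy ⊢
          exact Or.inl (lt_of_le_of_ne hxy fun h => hex ⟨rfl, h.symm⟩)
        · rwa [if_neg h, add_zero]
    have h1 := S.add_mem hR (S.smul_mem ((zetaTilde i j).coeff (-arrows j i)) hlast)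
    rw [sub_add_cancel] at h1
    have h2 := S.sub_mem
      (S.smul_mem ((-1 : GroundField I) ^ (if i = j then 1 else 0)) h1) hL
    rw [sub_sub_cancel] at h2
    exact (S.smul_mem_iff hR1.2).1 h2

omit [DecidableEq I] [Quiver I] [∀ i j : I, Fintype (i ⟶ j)] in
theorem exists_inversion (W : Fin N → I × ℤ) (h : ¬ Monotone fun e => code (W e)) :
    ∃ a b : Fin N, (a : ℕ) + 1 = b ∧ code (W b) < code (W a) := by
  cases N with
  | zero => exact absurd (fun a => a.elim0) h
  | succ N =>
    rw [Fin.monotone_iff_le_succ] at h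
    push Not at h
    obtain ⟨a, ha⟩ := h
    exact ⟨a.castSucc, a.succ, by simp, ha⟩

/-- Among the finitely many words of no larger energy that violate the claim, a lexicographically
minimal one would be reduced further by an inversion. -/
theorem shiftedElt_mem_sortedSpan (W : Fin N → I × ℤ) : shiftedElt W ∈ sortedSpan I := by
  by_contra hW
  obtain ⟨V, hV, hmin⟩ := Set.Finite.exists_minimalFor (wordCode (N := N) (I := I))
    {V | energy (arrowBound I) V ≤ energy (arrowBound I) W ∧ shiftedElt V ∉ sortedSpan I}
    ((finite_energy_le _ _).subset fun V hV => hV.1) ⟨W, le_rfl, hW⟩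
  refine hV.2 ?_
  by_cases hmono : Monotone fun e => code (V e)
  · exact Submodule.subset_span ⟨N, V, hmono, rfl⟩
  · obtain ⟨a, b, hab, hinv⟩ := exists_inversion V hmono
    refine shiftedElt_mem_of_inversion V hab hinv _ fun U hU hlt => ?_
    by_contra hUS
    exact hlt.not_ge (hmin ⟨hU.trans hV.1, hUS⟩ hlt.le)

theorem sortedSpan_eq_top : sortedSpan I = ⊤ := by
  rw [eq_top_iff, ← span_wordElt, Submodule.span_le]
  rintro _ ⟨⟨N, w⟩, rfl⟩
  have h := shiftedElt_mem_sortedSpan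
    fun e => ((w e).1, (w e).2 - shift (fun x => (w x).1) e)
  simp only [shiftedElt, sub_add_cancel] at h
  exact h

end Straightening

/-! ### Triangularity against orbit sums, and non-degeneracy in `φ`. -/

section Triangularity

/-- A monotone tuple is lexicographically smaller than its permutations. -/
theorem toLex_le_toLex_comp_perm {N : ℕ} {k : Fin N → ℤ} (hk : Monotone k)
    (π : Equiv.Perm (Fin N)) : toLex k ≤ toLex (k ∘ π) := by
  by_contra! h
  obtain ⟨a, hlt, ha⟩ := h
  have hlt' (e : Fin N) (he : e < a) : k (π e) = k e := hlt e he
  have ha' : k (π a) < k a := ha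
  -- A permutation preserves the number of entries below `k a`. At the first difference `a`,
  -- however, the permuted tuple has all those of `k`, which lie before `a`, and one more at `a`.
  have hcard : (Finset.univ.filter fun e => k (π e) < k a).card =
      (Finset.univ.filter fun e => k e < k a).card :=
    Finset.card_equiv π fun e => by simp
  have hsub : insert a (Finset.univ.filter fun e => k e < k a) ⊆
      Finset.univ.filter fun e => k (π e) < k a := by
    intro e he
    rw [Finset.mem_insert, Finset.mem_filter] at he
    rw [Finset.mem_filter]
    refine ⟨Finset.mem_univ e, ?_⟩
    rcases he with rfl | ⟨-, he⟩
    · exact ha'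
    · rwa [hlt' e (hk.reflect_lt he)]
  have := Finset.card_le_card hsub
  rw [Finset.card_insert_of_notMem (by simp), hcard] at this
  omega

variable {I : Type*} [Fintype I] [DecidableEq I] [Quiver I] {N : ℕ} {n : I → ℕ}

/-- The sum of the Laurent monomials in the orbit of the exponent vector `κ`. -/
def orbitSum (κ : (Σ i, Fin (n i)) → ℤ) : symLaurent (I := I) n where
  val := ∑ τ : ∀ i, Equiv.Perm (Fin (n i)),
    AddMonoidAlgebra.single (κ ∘ Equiv.sigmaCongrRight τ) 1
  property := by
    intro τ k
    simp only [AddMonoidAlgebra.coeff_sum, AddMonoidAlgebra.coeff_single, Finsupp.finsetSum_apply]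
    refine Fintype.sum_equiv (Equiv.mulRight τ⁻¹) _ _ fun τ' => ?_
    rw [Finsupp.single_apply, Finsupp.single_apply]
    refine if_congr ⟨fun h => ?_, fun h => ?_⟩ rfl rfl
    · funext p
      have := congrFun h ⟨p.1, (τ p.1)⁻¹ p.2⟩
      simpa using this
    · funext p
      have := congrFun h ⟨p.1, τ p.1 p.2⟩
      simpa using this

theorem coeff_orbitSum (κ k : (Σ i, Fin (n i)) → ℤ) :
    (orbitSum κ : LaurentPoly (I := I) n).coeff k =
      ((Finset.univ.filter fun τ : ∀ i, Equiv.Perm (Fin (n i)) =>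
        κ ∘ Equiv.sigmaCongrRight τ = k).card : GroundField I) := by
  change (∑ τ : ∀ i, Equiv.Perm (Fin (n i)),
    AddMonoidAlgebra.single (κ ∘ Equiv.sigmaCongrRight τ) 1 : LaurentPoly (I := I) n).coeff k = _
  simp only [AddMonoidAlgebra.coeff_sum, AddMonoidAlgebra.coeff_single, Finsupp.finsetSum_apply,
    Finsupp.single_apply, Finset.sum_boole]

/-- The coefficient is the order of a stabilizer, nonzero in characteristic zero. -/
theorem coeff_orbitSum_self (κ : (Σ i, Fin (n i)) → ℤ) :
    (orbitSum κ : LaurentPoly (I := I) n).coeff κ ≠ 0 := by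
  rw [coeff_orbitSum, Nat.cast_ne_zero, ← Nat.pos_iff_ne_zero, Finset.card_pos]
  refine ⟨1, Finset.mem_filter.2 ⟨Finset.mem_univ _, ?_⟩⟩
  funext p
  rfl

/-- The exponent vector of the monomial attached to a word. -/
def wordExponent (W : Fin N → I × ℤ) (σ : Fin N ≃ Σ i, Fin (n i)) : (Σ i, Fin (n i)) → ℤ :=
  fun p => -(W (σ.symm p)).2

theorem exists_perm_of_coeff_orbitSum {V W : Fin N → I × ℤ} {σ σ₀ : Fin N ≃ Σ i, Fin (n i)}
    (hσ : ∀ a, (σ a).1 = (V a).1) (hσ₀ : ∀ a, (σ₀ a).1 = (W a).1) {κ : (Σ i, Fin (n i)) → ℤ}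
    (hκ : (orbitSum (wordExponent W σ₀) : LaurentPoly (I := I) n).coeff κ ≠ 0) :
    ∃ π : Equiv.Perm (Fin N), κ ∘ σ = -((fun a => (W a).2) ∘ π) ∧
      ∀ a, (W (π a)).1 = (V a).1 := by
  rw [coeff_orbitSum, Nat.cast_ne_zero, ← Nat.pos_iff_ne_zero, Finset.card_pos] at hκ
  obtain ⟨τ, hτ⟩ := hκ
  rw [Finset.mem_filter] at hτ
  refine ⟨(σ.trans (Equiv.sigmaCongrRight τ)).trans σ₀.symm, ?_, fun a => ?_⟩
  · rw [← hτ.2]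
    rfl
  · rw [← hσ₀, Equiv.trans_apply, Equiv.apply_symm_apply, ← hσ]
    rfl

variable [∀ i j : I, Fintype (i ⟶ j)]

-- The first inequality is minimality of the sorted tuple; the second says that no coefficient of
-- the kernel occurs below its leading exponent, the correction by `shift` cancelling out.
omit [Fintype I] in
theorem coeff_kernel_ne_zero {V W : Fin N → I × ℤ} (hW : Monotone fun a => (W a).2)
    {π : Equiv.Perm (Fin N)}
    (h : (kernel fun a => (V a).1).coeff (toLex ((fun a => (V a).2 + shift (fun x => (V x).1) a) +
      -((fun a => (W a).2) ∘ π))) ≠ 0) :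
    toLex (fun a => (W a).2) ≤ toLex ((fun a => (W a).2) ∘ π) ∧
      toLex ((fun a => (W a).2) ∘ π) ≤ toLex fun a => (V a).2 := by
  refine ⟨toLex_le_toLex_comp_perm hW π, ?_⟩
  have h1 := (hasOrd_kernel fun a => (V a).1).le_of_coeff_ne_zero h
  have h2 : toLex ((fun a => (V a).2 + shift (fun x => (V x).1) a) + -((fun a => (W a).2) ∘ π)) =
      toLex (fun a => (V a).2) - toLex ((fun a => (W a).2) ∘ π) +
        toLex (shift fun x => (V x).1) := by
    rw [← toLex_sub, ← toLex_add]
    congr 1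
    funext a
    simp only [Pi.add_apply, Pi.neg_apply, Pi.sub_apply]
    ring
  rw [h2] at h1
  exact sub_nonneg.1 (le_add_iff_nonneg_left _ |>.1 h1)

/-- The shifted word attached to `W`. -/
def shiftedWord (W : Fin N → I × ℤ) : Fin N → I × ℤ :=
  fun e => ((W e).1, (W e).2 + shift (fun x => (W x).1) e)

/-- The two inequalities of `coeff_kernel_ne_zero` squeeze the permuted exponents, so a single
monomial contributes: its coefficient times the leading coefficient of the kernel. -/
theorem symForm_shiftedWord_self {W : Fin N → I × ℤ} (hW : Monotone fun a => (W a).2)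
    {σ : Fin N ≃ Σ i, Fin (n i)} (hσ : ∀ a, (σ a).1 = (W a).1) :
    symForm (shiftedWord W) n (orbitSum (wordExponent W σ)) ≠ 0 := by
  rw [symForm_eq (shiftedWord W) σ hσ, kernelForm_apply, Finsupp.sum,
    Finset.sum_eq_single (wordExponent W σ)]
  · refine mul_ne_zero (coeff_orbitSum_self _) ?_
    have h : (fun a => (shiftedWord W a).2) + wordExponent W σ ∘ σ = shift fun a => (W a).1 := by
      funext a
      simp [shiftedWord, wordExponent]
    rw [h]
    exact (hasOrd_kernel fun a => (W a).1).coeff_ne_zero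
  · intro κ hκ hne
    by_contra h
    obtain ⟨π, hπ, -⟩ := exists_perm_of_coeff_orbitSum hσ hσ (Finsupp.mem_support_iff.1 hκ)
    have h' := right_ne_zero_of_mul h
    rw [hπ] at h'
    obtain ⟨h1, h2⟩ := coeff_kernel_ne_zero (V := W) hW h'
    have h3 := toLex.injective (h2.antisymm h1)
    refine hne (σ.surjective.injective_comp_right (hπ.trans ?_))
    rw [h3]
    funext a
    simp [wordExponent]
  · intro h
    exact absurd (Finsupp.notMem_support_iff.1 h) (coeff_orbitSum_self _)

theorem eq_of_symForm_shiftedWord_ne_zero {V W : Fin N → I × ℤ}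
    (hV : Monotone fun a => code (V a)) (hW : Monotone fun a => code (W a))
    {σ₀ : Fin N ≃ Σ i, Fin (n i)} (hσ₀ : ∀ a, (σ₀ a).1 = (W a).1)
    (h : symForm (shiftedWord V) n (orbitSum (wordExponent W σ₀)) ≠ 0) :
    toLex (fun a => (W a).2) ≤ toLex (fun a => (V a).2) ∧
      ((fun a => (W a).2) = (fun a => (V a).2) → V = W) := by
  have hW2 : Monotone fun a => (W a).2 := fun a b hab => Prod.Lex.monotone_fst _ _ (hW hab)
  by_cases hσ : ∃ σ : Fin N ≃ Σ i, Fin (n i), ∀ a, (σ a).1 = (V a).1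
  · obtain ⟨σ, hσ⟩ := hσ
    rw [symForm_eq (shiftedWord V) σ hσ, kernelForm_apply] at h
    obtain ⟨κ, hκ, hne⟩ := Finset.exists_ne_zero_of_sum_ne_zero h
    obtain ⟨π, hπ, hcol⟩ := exists_perm_of_coeff_orbitSum hσ hσ₀ (Finsupp.mem_support_iff.1 hκ)
    have h' := right_ne_zero_of_mul hne
    rw [hπ] at h'
    obtain ⟨h1, h2⟩ := coeff_kernel_ne_zero (V := V) hW2 h'
    refine ⟨h1.trans h2, fun heq => ?_⟩
    rw [heq] at h1 h2
    have h3 : (fun a => (V a).2) ∘ π = fun a => (V a).2 := toLex.injective (h2.antisymm h1)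
    have hVW : V = W ∘ π := by
      funext a
      refine Prod.ext (hcol a).symm ?_
      exact (congrFun h3 a).symm.trans (congrFun heq (π a)).symm
    -- With equal exponents `V` is a permutation of `W`; sorting also by colour makes the
    -- arrangement unique.
    have h4 := Tuple.unique_monotone (f := fun a => code (W a)) (σ := π) (τ := 1)
      (by rw [hVW] at hV; exact hV) hW
    rw [hVW]
    funext a
    exact code_injective (congrFun h4 a)
  · exact absurd (by rw [symForm_eq_zero (shiftedWord V) hσ, LinearMap.zero_apply]) h

theorem separatingLeft_of_isShufflePairing
    {P : QuadLoopGroup I →ₗ[GroundField I] BigShuffle I →ₗ[GroundField I] GroundField I}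
    (hP : IsShufflePairing P) : P.SeparatingLeft := by
  rw [isShufflePairing_iff] at hP
  intro φ hφ
  have hspan : φ ∈ Submodule.span (GroundField I) (Set.range
      fun s : {s : Σ N, Fin N → I × ℤ // Monotone fun e => code (s.2 e)} =>
        shiftedElt s.1.2) := by
    have h : φ ∈ sortedSpan I := by
      rw [sortedSpan_eq_top]
      trivial
    refine Submodule.span_mono ?_ h
    rintro _ ⟨N, W, hW, rfl⟩
    exact ⟨⟨⟨N, W⟩, hW⟩, rfl⟩
  obtain ⟨c, rfl⟩ := Finsupp.mem_span_range_iff_exists_finsupp.1 hspan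
  by_contra hne
  have hc : c.support.Nonempty := by
    rw [Finset.nonempty_iff_ne_empty]
    intro h
    exact hne (by rw [Finsupp.sum, h, Finset.sum_empty])
  -- Maximality is in exponents only, among words of the same length; colours are settled afterwards
  -- by `eq_of_symForm_shiftedWord_ne_zero`.
  obtain ⟨⟨⟨N, W⟩, hW⟩, hs, hmax⟩ := Finset.exists_maximalFor
    (fun s : {s : Σ N, Fin N → I × ℤ // Monotone fun e => code (s.2 e)} =>
      (⟨s.1.1, toLex fun a => (s.1.2 a).2⟩ : Σ N, Lex (Fin N → ℤ))) c.support hc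
  obtain ⟨σ₀, hσ₀⟩ := (hdeg_eq_iff W).1 rfl
  have h0 := hφ (DirectSum.of (fun n => symLaurent n) (hdeg W) (orbitSum (wordExponent W σ₀)))
  rw [Finsupp.sum, map_sum, LinearMap.sum_apply, Finset.sum_eq_single_of_mem _ hs] at h0
  · rw [map_smul, LinearMap.smul_apply, smul_eq_mul] at h0
    rcases mul_eq_zero.1 h0 with h | h
    · exact Finsupp.mem_support_iff.1 hs h
    · have hform : P (shiftedElt W) = wordForm (shiftedWord W) := hP _ _
      rw [hform, wordForm_of] at h
      exact symForm_shiftedWord_self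
        (fun a b hab => Prod.Lex.monotone_fst _ _ (hW hab)) hσ₀ h
  · rintro ⟨⟨M, V⟩, hV⟩ hs' hne'
    rw [map_smul, LinearMap.smul_apply]
    have hform : P (shiftedElt V) = wordForm (shiftedWord V) := hP _ _
    by_contra h
    have h2 : symForm (shiftedWord V) (hdeg W) (orbitSum (wordExponent W σ₀)) ≠ 0 := by
      intro h2
      refine h ?_
      change _ • P (shiftedElt V) _ = 0
      rw [hform, wordForm_of, h2, smul_zero]
    have hMN : M = N := by
      by_contra hMN
      refine h2 ?_
      rw [symForm_eq_zero, LinearMap.zero_apply]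
      rintro ⟨σ, -⟩
      exact hMN (by simpa using Fintype.card_congr (σ.trans σ₀.symm))
    subst hMN
    obtain ⟨h3, h4⟩ := eq_of_symForm_shiftedWord_ne_zero hV hW hσ₀ h2
    have h5 := hmax hs' (Sigma.mk_le_mk_iff.2 h3)
    have h6 := Sigma.mk_le_mk_iff.1 h5
    have h7 := h4 (toLex.injective (h3.antisymm h6))
    subst h7
    exact hne' rfl

end Triangularity

end QuiverShuffle

end

theorem corollary2p8 (I : Type*) [Fintype I] [DecidableEq I] [Quiver I]
    [∀ i j : I, Fintype (i ⟶ j)] :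
    (∃! P : QuiverShuffle.QuadLoopGroup I →ₗ[QuiverShuffle.GroundField I]
        QuiverShuffle.BigShuffle I →ₗ[QuiverShuffle.GroundField I] QuiverShuffle.GroundField I,
      QuiverShuffle.IsShufflePairing P) ∧
    ∀ P : QuiverShuffle.QuadLoopGroup I →ₗ[QuiverShuffle.GroundField I]
        QuiverShuffle.BigShuffle I →ₗ[QuiverShuffle.GroundField I] QuiverShuffle.GroundField I,
      QuiverShuffle.IsShufflePairing P → P.Nondegenerate :=
  ⟨QuiverShuffle.existsUnique_shufflePairing, fun _ hP =>
    ⟨QuiverShuffle.separatingLeft_of_isShufflePairing hP,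
      QuiverShuffle.separatingRight_of_isShufflePairing hP⟩⟩
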